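/- Let $(\mathcal F,\Sigma)$ be a measurable space of models and let $\mathcal M(\mathcal F)$ be the set of probability measures on $\mathcal F$, with the $\sigma$-algebra generated by the maps $P\mapsto P(A)$, $A\in\Sigma$. Let $n\ge 1$ and, for $i=1,\dots,n$, let $D_i$ be a probability measure on a measurable space $\mathcal Z_i$, let $\ell_i:\mathcal F\times\mathcal Z_i\to[0,1]$ be a (jointly measurable) loss, and let $m_i\ge 1$; put $M=\sum_{i=1}^n m_i$. The training datasets $S_i=(z_{i1},\dots,z_{im_i})$ consist of independent samples $z_{ij}\sim D_i$, and are independent of each other. For probability measures $Q_1,\dots,Q_n$ on $\mathcal F$ put $\ell_i(Q_i,z)=\mathbb E_{f\sim Q_i}\,\ell_i(f,z)$ and $$R^S=\sum_{i=1}^n\frac{m_i}{M}\,\mathbb E_{z\sim D_i}\,\ell_i(Q_i,z),\qquad \hat R^S=\sum_{i=1}^n\frac{m_i}{M}\cdot\frac1{m_i}\sum_{j=1}^{m_i}\ell_i(Q_i,z_{ij}).$$ For $p,q\in[0,1]$ let $$\mathrm{kl}(q|p)=q\log\frac qp+(1-q)\log\frac{1-q}{1-p}\in[0,\infty],$$ with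 the conventions $0\log\frac 0b=0$ and $a\log\frac a0=\infty$ for $a>0$. Fix a hyper-prior $\mathcal P$, i.e. a probability measure on $\mathcal M(\mathcal F)$ that does not depend on the data, and let $\mathfrak P$ be the law of $(P,f_1,\dots,f_n)$ on $\mathcal M(\mathcal F)\times\mathcal F^n$, where $P\sim\mathcal P$ and, given $P$, the $f_1,\dots,f_n$ are drawn independently from $P$. For a hyper-posterior $\mathcal Q$ (a probability measure on $\mathcal M(\mathcal F)$) and posteriors $Q_1,\dots,Q_n$ (probability measures on $\mathcal F$), which may all depend on the data, let $\mathfrak Q=\mathcal Q\times Q_1\times\dots\times Q_n$, and let $\mathrm{KL}(\mathfrak Q\|\mathfrak P)\in[0,\infty]$ be the Kullback--Leibler divergence. Let $\delta>0$. (i) With probability at least $1-\delta$ over the sampling of $S_1,\dots,S_n$, the following holds for all hyper-posteriors $\mathcal Q$ and all posteriors $Q_1,\dots,Q_n$ simultaneously: $$\mathrm{kl}(\hat R^S\,|\,R^S)\le\frac{\mathrm{KL}(\mathfrak Q\|\mathfrak P)+\log\frac{2\sqrt M}{\delta}}{M}.$$ (ii) For every fixed $\lambda>0$, with probability at least $1-\delta$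 over the sampling of $S_1,\dots,S_n$, the following holds for all hyper-posteriors $\mathcal Q$ and all posteriors $Q_1,\dots,Q_n$ simultaneously: $$-\frac M\lambda\log\bigl(1-R^S+R^S e^{-\lambda/M}\bigr)\le\hat R^S+\frac{\mathrm{KL}(\mathfrak Q\|\mathfrak P)+\log\frac1\delta}{\lambda}.$$ Here "with probability at least $1-\delta$" means that there is a measurable set of datasets, of probability at least $1-\delta$, on which the statement holds. -/

import Mathlib

open MeasureTheory ProbabilityTheory InformationTheory
open scoped ENNReal

namespace MTL

/-- The space `M(F)` of probability measures on the model space `F`, with the σ-algebra generated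
by the evaluations `P ↦ P s`, `s` measurable (the trace of the Giry σ-algebra). -/
abbrev Models (F : Type*) [MeasurableSpace F] : Type _ :=
  {P : Measure F // IsProbabilityMeasure P}

/-- `a log (a / b)` for `a, b ≥ 0`, with `0 log (0 / b) = 0` and `a log (a / 0) = ∞` for `a > 0`. -/
noncomputable def mulLogDiv (a b : ℝ) : EReal :=
  if a = 0 then 0 else if b = 0 then ⊤ else ((a * Real.log (a / b) : ℝ) : EReal)

/-- The binary divergence `kl(q|p) = q log (q/p) + (1-q) log ((1-q)/(1-p))` for `p, q ∈ [0,1]`. -/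
noncomputable def binKL (q p : ℝ) : EReal :=
  mulLogDiv q p + mulLogDiv (1 - q) (1 - p)

/-- `P ↦ P ⊗ ⋯ ⊗ P` (`n` factors) depends measurably on `P`. -/
theorem measurable_pi_const (F : Type*) [MeasurableSpace F] (n : ℕ) :
    Measurable (fun P : Models F => Measure.pi (fun _ : Fin n => P.1)) := by
  have hp : ∀ P : Models F, IsProbabilityMeasure P.1 := fun P => P.2
  refine Measurable.measure_of_isPiSystem_of_isProbabilityMeasure
    (S := Set.pi Set.univ '' Set.pi Set.univ fun _ : Fin n => {s : Set F | MeasurableSet s})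
    generateFrom_pi.symm isPiSystem_pi ?_
  rintro _ ⟨s, hs, rfl⟩
  simp only [Measure.pi_pi]
  exact Finset.measurable_prod _ fun i _ =>
    (Measure.measurable_coe (hs i (Set.mem_univ i))).comp measurable_subtype_coe

/-- The Markov kernel that sends a prior `P` to the law of `n` independent models drawn from `P`. -/
noncomputable def iidKernel (F : Type*) [MeasurableSpace F] (n : ℕ) :
    Kernel (Models F) (Fin n → F) where
  toFun P := Measure.pi (fun _ : Fin n => P.1)
  measurable' := measurable_pi_const F n

instance iidKernel_isMarkovKernel (F : Type*) [MeasurableSpace F] (n : ℕ) :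
    IsMarkovKernel (iidKernel F n) :=
  ⟨fun P => by
    have := P.2
    change IsProbabilityMeasure (Measure.pi fun _ : Fin n => P.1)
    infer_instance⟩

/-- The law of `(P, f₁, …, fₙ)` where `P` has law `hyperprior` and, given `P`, the models
`f₁, …, fₙ` are drawn independently from `P`. -/
noncomputable def jointPrior {F : Type*} [MeasurableSpace F] (n : ℕ)
    (hyperprior : Measure (Models F)) : Measure (Models F × (Fin n → F)) :=
  hyperprior ⊗ₘ iidKernel F n

/-- The product law `hyperpost × Q₁ × ⋯ × Qₙ`. -/
noncomputable def jointPosterior {F : Type*} [MeasurableSpace F] {n : ℕ}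
    (hyperpost : Measure (Models F)) (Q : Fin n → Measure F) :
    Measure (Models F × (Fin n → F)) :=
  hyperpost.prod (Measure.pi Q)

/-- The law of the training data: all `z i j` are independent and `z i j` has law `D i`. -/
noncomputable def dataLaw {n : ℕ} {Z : Fin n → Type*} [∀ i, MeasurableSpace (Z i)]
    (m : Fin n → ℕ) (D : ∀ i, Measure (Z i)) : Measure (∀ i, Fin (m i) → Z i) :=
  Measure.pi fun i => Measure.pi fun _ : Fin (m i) => D i

/-- The loss of a stochastic model, `ℓ(Q, z) = E_{f ∼ Q} ℓ(f, z)`. -/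
noncomputable def gibbsLoss {F Z : Type*} [MeasurableSpace F]
    (loss : F → Z → ℝ) (Q : Measure F) (z : Z) : ℝ :=
  ∫ f, loss f z ∂Q

/-- The risk of a single task. -/
noncomputable def risk {F Z : Type*} [MeasurableSpace F] [MeasurableSpace Z]
    (D : Measure Z) (loss : F → Z → ℝ) (Q : Measure F) : ℝ :=
  ∫ z, gibbsLoss loss Q z ∂D

/-- The training risk of a single task with training set `z`. -/
noncomputable def empRisk {F Z : Type*} [MeasurableSpace F] {k : ℕ}
    (loss : F → Z → ℝ) (Q : Measure F) (z : Fin k → Z) : ℝ :=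
  (1 / (k : ℝ)) * ∑ j, gibbsLoss loss Q (z j)

/-- The total number `M` of samples. -/
def totalSamples {n : ℕ} (m : Fin n → ℕ) : ℕ := ∑ i, m i

/-- The sample-centric risk `∑ᵢ (mᵢ / M) erᵢ(Qᵢ)`. -/
noncomputable def sampleRisk {F : Type*} [MeasurableSpace F] {n : ℕ} {Z : Fin n → Type*}
    [∀ i, MeasurableSpace (Z i)] (m : Fin n → ℕ) (D : ∀ i, Measure (Z i))
    (loss : ∀ i, F → Z i → ℝ) (Q : Fin n → Measure F) : ℝ :=
  ∑ i, ((m i : ℝ) / (totalSamples m : ℝ)) * risk (D i) (loss i) (Q i)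

/-- The sample-centric training risk `∑ᵢ (mᵢ / M) êrᵢ(Qᵢ)`. -/
noncomputable def sampleEmpRisk {F : Type*} [MeasurableSpace F] {n : ℕ} {Z : Fin n → Type*}
    (m : Fin n → ℕ) (loss : ∀ i, F → Z i → ℝ) (Q : Fin n → Measure F)
    (S : ∀ i, Fin (m i) → Z i) : ℝ :=
  ∑ i, ((m i : ℝ) / (totalSamples m : ℝ)) * empRisk (loss i) (Q i) (S i)

end MTL

/-! Write M for the number of examples. For a model tuple f, let x be the vector of its M training
losses, r the vector of its expected losses and p the mean of r, and consider the tilt exp(t Σ x − M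
log(1 − p + p eᵗ)). Bounding each eᵗˣ by its chord on [0,1], independence and AM-GM show that the
tilt has expectation at most 1 over the data (`lintegral_exp_tilt_le`). Markov's inequality under
the joint prior, the Donsker–Varadhan inequality and Jensen for the concave map p ↦ log(1 − p + p
eᵗ) turn this into a bound for all posteriors (`exists_event_forall_tilt_le`). The choice t = −λ/M
gives (ii).

For (i), kl(q|p) is the supremum over t of tq − log(1 − p + p eᵗ) (`binKL_le`), so one event must
serve all t. After the chord bound the tilt is a sum over binary words of length M, and t enters
each summand only through the likelihood of the word under the Bernoulli parameter p eᵗ/(1 − p + p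
eᵗ). The Krichevsky–Trofimov mixture, with prior Beta(1/2, 1/2), dominates all these likelihoods up
to the factor 2√M (`pow_mul_pow_le_mixtureProb`). The resulting `mixtureBound` is free of t and
affine in each loss, so its expectation is its value at r. That value is at most 2√M times an
integral over the Bernoulli parameter of products that AM-GM bounds by 1 (`mixtureBound_mean_le`).
-/

namespace MTL

/-! ### Regret of the Krichevsky–Trofimov mixture -/

/-- Padé upper bound for the logarithm. -/
theorem log_one_add_le_pade {x : ℝ} (hx : 0 ≤ x) :
    Real.log (1 + x) ≤ x * (6 + x) / (6 + 4 * x) := by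
  let f : ℝ → ℝ := fun y => y * (6 + y) / (6 + 4 * y) - Real.log (1 + y)
  have hd : ∀ y ∈ Set.Ici (0 : ℝ), HasDerivAt f
      (((1 * (6 + y) + y * 1) * (6 + 4 * y) - y * (6 + y) * (4 * 1)) / (6 + 4 * y) ^ 2
        - 1 / (1 + y)) y := by
    intro y hy
    have hy : (0 : ℝ) ≤ y := hy
    have h1 : HasDerivAt (fun y : ℝ => y) 1 y := hasDerivAt_id y
    exact ((h1.mul (h1.const_add 6)).div ((h1.const_mul 4).const_add 6) (by positivity)).sub
      ((h1.const_add 1).log (by positivity))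
  have hmono : MonotoneOn f (Set.Ici 0) := by
    refine monotoneOn_of_deriv_nonneg (convex_Ici 0)
      (fun y hy => (hd y hy).continuousAt.continuousWithinAt) ?_ ?_
    · intro y hy
      exact (hd y (interior_subset hy)).differentiableAt.differentiableWithinAt
    · intro y hy
      have hy0 : (0 : ℝ) ≤ y := interior_subset hy
      rw [(hd y hy0).deriv]
      have : ((1 * (6 + y) + y * 1) * (6 + 4 * y) - y * (6 + y) * (4 * 1)) / (6 + 4 * y) ^ 2
        - 1 / (1 + y) = 4 * y ^ 3 / ((6 + 4 * y) ^ 2 * (1 + y)) := by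
        field_simp
        ring
      rw [this]
      positivity
  have := hmono (Set.mem_Ici.2 le_rfl) (Set.mem_Ici.2 hx) hx
  simp only [f] at this
  norm_num at this
  exact this

/-- After taking logarithms this is (n + 1/2) log(1 + 1/n) ≥ 1, which follows from log(1 + x) ≥
2x/(x + 2). -/
theorem exp_one_mul_sqrt_mul_pow_le {n : ℕ} (hn : 0 < n) :
    Real.exp 1 * (√(n : ℝ) * (n : ℝ) ^ n) ≤ √((n : ℝ) + 1) * ((n : ℝ) + 1) ^ n := by
  have hn' : (0 : ℝ) < n := by exact_mod_cast hn
  have h := Real.le_log_one_add_of_nonneg (x := 1 / (n : ℝ)) (by positivity)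
  have e : (1 : ℝ) + 1 / n = (n + 1) / n := by field_simp
  rw [e, Real.log_div (by positivity) (by positivity)] at h
  have e2 : 2 * (1 / (n : ℝ)) / (1 / n + 2) = 1 / (n + 1 / 2) := by field_simp; ring
  rw [e2, div_le_iff₀ (by positivity)] at h
  rw [← Real.log_le_log_iff (by positivity) (by positivity), Real.log_mul (by positivity)
    (by positivity), Real.log_mul (by positivity) (by positivity), Real.log_mul (by positivity)
    (by positivity), Real.log_exp, Real.log_sqrt (by positivity), Real.log_sqrt (by positivity),
    Real.log_pow, Real.log_pow]
  nlinarith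

/-- For b > 0, taking logarithms leaves b log(1 + 1/b) + log(1 + 1/(2b + 1)) ≤ 1. The Padé bound is
precise enough for both terms: once denominators are cleared, the quadratic coefficients of the two
sides agree. -/
theorem succ_pow_succ_le (b : ℕ) :
    ((b : ℝ) + 1) ^ (b + 1) ≤ Real.exp 1 * ((b : ℝ) + 1 / 2) * (b : ℝ) ^ b := by
  rcases Nat.eq_zero_or_pos b with rfl | hb
  · have := Real.add_one_le_exp (1 : ℝ)
    norm_num
    linarith
  have hb' : (0 : ℝ) < b := by exact_mod_cast hb
  have h1 := log_one_add_le_pade (x := 1 / (b : ℝ)) (by positivity)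
  have h2 := log_one_add_le_pade (x := 1 / (2 * (b : ℝ) + 1)) (by positivity)
  have e1 : (1 : ℝ) + 1 / b = (b + 1) / b := by field_simp
  have e2 : (1 : ℝ) + 1 / (2 * b + 1) = (b + 1) / (b + 1 / 2) := by field_simp; ring
  rw [e1, Real.log_div (by positivity) (by positivity)] at h1
  rw [e2, Real.log_div (by positivity) (by positivity)] at h2
  have h1' := mul_le_mul_of_nonneg_left h1 hb'.le
  have key : (b : ℝ) * (1 / (b : ℝ) * (6 + 1 / b) / (6 + 4 * (1 / b))) +
      1 / (2 * (b : ℝ) + 1) * (6 + 1 / (2 * b + 1)) / (6 + 4 * (1 / (2 * b + 1))) ≤ 1 := by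
    have e3 : (b : ℝ) * (1 / (b : ℝ) * (6 + 1 / b) / (6 + 4 * (1 / b))) = (6 * b + 1) / (6 * b + 4) := by
      field_simp
    have e4 : 1 / (2 * (b : ℝ) + 1) * (6 + 1 / (2 * b + 1)) / (6 + 4 * (1 / (2 * b + 1))) =
        (12 * b + 7) / ((2 * b + 1) * (12 * b + 10)) := by
      field_simp
      ring
    rw [e3, e4, div_add_div _ _ (by positivity) (by positivity), div_le_one (by positivity)]
    nlinarith [sq_nonneg (b : ℝ)]
  rw [← Real.log_le_log_iff (by positivity) (by positivity), Real.log_mul (by positivity)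
    (by positivity), Real.log_mul (by positivity) (by positivity), Real.log_exp,
    Real.log_pow, Real.log_pow]
  push_cast
  nlinarith

/-- The probability that the Krichevsky–Trofimov mixture assigns to a binary word with `a` ones
and `b` zeros. -/
noncomputable def mixtureProb (a b : ℕ) : ℝ :=
  ∫ q, q ^ a * (1 - q) ^ b ∂betaMeasure (1 / 2) (1 / 2)

theorem integral_betaPDFReal {α β : ℝ} (hα : 0 < α) (hβ : 0 < β) :
    ∫ x, betaPDFReal α β x = 1 := by
  have hnn : ∀ x, 0 ≤ betaPDFReal α β x := by
    intro x
    by_cases h : 0 < x ∧ x < 1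
    · exact (betaPDFReal_pos h.1 h.2 hα hβ).le
    · simp [betaPDFReal, h]
  rw [integral_eq_lintegral_of_nonneg_ae (Filter.Eventually.of_forall hnn)
    (measurable_betaPDFReal α β).aestronglyMeasurable]
  change (∫⁻ x, betaPDF α β x).toReal = 1
  rw [lintegral_betaPDF_eq_one hα hβ, ENNReal.toReal_one]

theorem mixtureProb_eq (a b : ℕ) :
    mixtureProb a b = beta (a + 1 / 2) (b + 1 / 2) / beta (1 / 2) (1 / 2) := by
  have hpos : 0 < beta (1 / 2) (1 / 2) := beta_pos (by norm_num) (by norm_num)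
  have hpos' : 0 < beta (a + 1 / 2 : ℝ) (b + 1 / 2) := beta_pos (by positivity) (by positivity)
  have hm : Measurable (betaPDF (1 / 2) (1 / 2)) :=
    ENNReal.measurable_ofReal.comp (measurable_betaPDFReal _ _)
  rw [mixtureProb, betaMeasure, integral_withDensity_eq_integral_toReal_smul hm
    (Filter.Eventually.of_forall fun x => ENNReal.ofReal_lt_top)]
  have : ∀ x : ℝ, (betaPDF (1 / 2) (1 / 2) x).toReal • (x ^ a * (1 - x) ^ b) =
      beta (a + 1 / 2) (b + 1 / 2) / beta (1 / 2) (1 / 2) *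
        betaPDFReal (a + 1 / 2) (b + 1 / 2) x := by
    intro x
    by_cases h : 0 < x ∧ x < 1
    · have h1 : 0 < 1 - x := by linarith [h.2]
      rw [betaPDF, ENNReal.toReal_ofReal (betaPDFReal_pos h.1 h.2 (by norm_num) (by norm_num)).le]
      simp only [betaPDFReal, h, and_self, if_true, smul_eq_mul]
      have ea : x ^ ((a : ℝ) + 1 / 2 - 1) = x ^ a * x ^ ((1 : ℝ) / 2 - 1) := by
        rw [← Real.rpow_natCast, ← Real.rpow_add h.1]; congr 1; ring
      have eb : (1 - x) ^ ((b : ℝ) + 1 / 2 - 1) = (1 - x) ^ b * (1 - x) ^ ((1 : ℝ) / 2 - 1) := by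
        rw [← Real.rpow_natCast, ← Real.rpow_add h1]; congr 1; ring
      rw [ea, eb]
      generalize beta (1 / 2) (1 / 2) = B at *
      generalize beta ((a : ℝ) + 1 / 2) (b + 1 / 2) = B' at *
      field_simp
    · simp [betaPDF, betaPDFReal, h]
  simp_rw [this]
  rw [integral_const_mul, integral_betaPDFReal (by positivity) (by positivity), mul_one]

theorem mixtureProb_zero_zero : mixtureProb 0 0 = 1 := by
  rw [mixtureProb_eq]
  simp only [Nat.cast_zero, zero_add]
  exact div_self (beta_pos (by norm_num) (by norm_num)).ne'

theorem mixtureProb_comm (a b : ℕ) : mixtureProb a b = mixtureProb b a := by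
  simp only [mixtureProb_eq, beta, mul_comm, add_comm]

/-- After a ones and b zeros the mixture predicts a zero with probability (b + 1/2)/(a + b + 1).
This is the functional equation of Γ. -/
theorem mixtureProb_succ_right (a b : ℕ) :
    ((a : ℝ) + b + 1) * mixtureProb a (b + 1) = ((b : ℝ) + 1 / 2) * mixtureProb a b := by
  have hg : ∀ k : ℕ, 0 < Real.Gamma ((k : ℝ) + 1 / 2) :=
    fun k => Real.Gamma_pos_of_pos (by positivity)
  have hs : (0 : ℝ) < Real.Gamma ((a : ℝ) + 1 / 2 + (b + 1 / 2)) :=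
    Real.Gamma_pos_of_pos (by positivity)
  have hb : ((b + 1 : ℕ) : ℝ) + 1 / 2 = (b + 1 / 2) + 1 := by push_cast; ring
  have e1 : Real.Gamma ((b : ℝ) + 1 / 2 + 1) = (b + 1 / 2) * Real.Gamma (b + 1 / 2) :=
    Real.Gamma_add_one (by positivity)
  have e2 : Real.Gamma ((a : ℝ) + 1 / 2 + (b + 1 / 2 + 1)) =
      (a + 1 / 2 + (b + 1 / 2)) * Real.Gamma ((a : ℝ) + 1 / 2 + (b + 1 / 2)) := by
    rw [← add_assoc]
    exact Real.Gamma_add_one (by positivity)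
  have hpos : 0 < beta (1 / 2) (1 / 2) := beta_pos (by norm_num) (by norm_num)
  rw [mixtureProb_eq, mixtureProb_eq, hb]
  simp only [beta, e1, e2] at hpos ⊢
  field_simp
  ring

theorem mixtureProb_pos (a b : ℕ) : 0 < mixtureProb a b := by
  rw [mixtureProb_eq]
  exact div_pos (beta_pos (by positivity) (by positivity)) (beta_pos (by norm_num) (by norm_num))

/-- Adding a zero preserves the Krichevsky–Trofimov regret bound. -/
theorem regret_step {a b : ℕ} (hab : 0 < a + b)
    (h : (a : ℝ) ^ a * (b : ℝ) ^ b ≤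
      2 * √((a : ℝ) + b) * ((a : ℝ) + b) ^ (a + b) * mixtureProb a b) :
    (a : ℝ) ^ a * ((b : ℝ) + 1) ^ (b + 1) ≤
      2 * √((a : ℝ) + b + 1) * ((a : ℝ) + b + 1) ^ (a + b + 1) * mixtureProb a (b + 1) := by
  have h1 := succ_pow_succ_le b
  have h2 := exp_one_mul_sqrt_mul_pow_le hab
  push_cast at h2
  have hr := mixtureProb_succ_right a b
  have hp := mixtureProb_pos a b
  -- The left side grows by at most e(b + 1/2). The recursion of the mixture absorbs b + 1/2, and
  -- the growth of √n nⁿ absorbs e.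
  calc (a : ℝ) ^ a * ((b : ℝ) + 1) ^ (b + 1)
      ≤ (a : ℝ) ^ a * (Real.exp 1 * ((b : ℝ) + 1 / 2) * (b : ℝ) ^ b) := by gcongr
    _ = Real.exp 1 * ((b : ℝ) + 1 / 2) * ((a : ℝ) ^ a * (b : ℝ) ^ b) := by ring
    _ ≤ Real.exp 1 * ((b : ℝ) + 1 / 2) *
        (2 * √((a : ℝ) + b) * ((a : ℝ) + b) ^ (a + b) * mixtureProb a b) := by gcongr
    _ = 2 * ((b : ℝ) + 1 / 2) * mixtureProb a b *
        (Real.exp 1 * (√((a : ℝ) + b) * ((a : ℝ) + b) ^ (a + b))) := by ring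
    _ ≤ 2 * ((b : ℝ) + 1 / 2) * mixtureProb a b *
        (√((a : ℝ) + b + 1) * ((a : ℝ) + b + 1) ^ (a + b)) := by gcongr
    _ = 2 * √((a : ℝ) + b + 1) * ((a : ℝ) + b + 1) ^ (a + b) *
        (((b : ℝ) + 1 / 2) * mixtureProb a b) := by ring
    _ = _ := by rw [← hr]; ring

/-- The constant 2 is fixed by words of length one, where the mixture gives 1/2 and equality holds.
`regret_step` adds zeros; symmetry of the mixture starts the induction at words made of ones only.
-/
theorem pow_self_mul_pow_self_le (a b : ℕ) (hab : 0 < a + b) :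
    (a : ℝ) ^ a * (b : ℝ) ^ b ≤
      2 * √((a : ℝ) + b) * ((a : ℝ) + b) ^ (a + b) * mixtureProb a b := by
  have base : mixtureProb 0 1 = 1 / 2 := by
    have := mixtureProb_succ_right 0 0
    rw [mixtureProb_zero_zero] at this
    norm_num at this
    linarith
  have h0 : ∀ b : ℕ, 0 < b → (b : ℝ) ^ b ≤ 2 * √(b : ℝ) * (b : ℝ) ^ b * mixtureProb 0 b := by
    intro b hb
    induction b, hb using Nat.le_induction with
    | base => norm_num [base]
    | succ k hk ih =>
      have := regret_step (a := 0) (b := k) (by omega) (by simpa using ih)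
      simpa using this
  induction b with
  | zero =>
    have := h0 a (by omega)
    rw [mixtureProb_comm] at this
    simpa using this
  | succ k ih =>
    rcases Nat.eq_zero_or_pos (a + k) with h | h
    · obtain ⟨rfl, rfl⟩ : a = 0 ∧ k = 0 := by omega
      simpa using h0 1 one_pos
    · have := regret_step h (ih h)
      push_cast
      simpa [add_assoc] using this

/-- This is the a-th power of y/a ≤ exp(y/a − 1). Applied to (a + b)x and (a + b)(1 − x), the
exponentials cancel and the maximum of the likelihood xᵃ(1 − x)ᵇ appears. -/
theorem mul_pow_le_pow_self_mul_exp (a : ℕ) {y : ℝ} (hy : 0 ≤ y) :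
    y ^ a ≤ (a : ℝ) ^ a * Real.exp (y - a) := by
  rcases Nat.eq_zero_or_pos a with rfl | ha
  · simpa using hy
  have ha' : (0 : ℝ) < a := by exact_mod_cast ha
  have h : y / a ≤ Real.exp (y / a - 1) := by linarith [Real.add_one_le_exp (y / a - 1)]
  have h2 := pow_le_pow_left₀ (by positivity) h a
  rw [← Real.exp_nat_mul, div_pow, div_le_iff₀ (by positivity)] at h2
  have e : (a : ℝ) * (y / a - 1) = y - a := by field_simp
  rw [e] at h2
  linarith

/-- The worst-case regret of the Krichevsky–Trofimov mixture is at most `log (2 √(a + b))`. -/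
theorem pow_mul_pow_le_mixtureProb {a b : ℕ} (hab : 0 < a + b) {x : ℝ} (hx : x ∈ Set.Icc (0 : ℝ) 1) :
    x ^ a * (1 - x) ^ b ≤ 2 * √((a : ℝ) + b) * mixtureProb a b := by
  have hM : (0 : ℝ) < (a : ℝ) + b := by exact_mod_cast hab
  have h1 : (0 : ℝ) ≤ 1 - x := by linarith [hx.2]
  have ha := mul_pow_le_pow_self_mul_exp a (mul_nonneg hM.le hx.1)
  have hb := mul_pow_le_pow_self_mul_exp b (mul_nonneg hM.le h1)
  have h := mul_le_mul ha hb (pow_nonneg (mul_nonneg hM.le h1) _) (by positivity)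
  have hs : Real.exp (((a : ℝ) + b) * x - a) * Real.exp (((a : ℝ) + b) * (1 - x) - b) = 1 := by
    rw [← Real.exp_add]; ring_nf; exact Real.exp_zero
  have h3 : ((a : ℝ) + b) ^ (a + b) * (x ^ a * (1 - x) ^ b) ≤ (a : ℝ) ^ a * (b : ℝ) ^ b := by
    calc _ = (((a : ℝ) + b) * x) ^ a * (((a : ℝ) + b) * (1 - x)) ^ b := by
            rw [mul_pow, mul_pow, pow_add]; ring
      _ ≤ _ := h
      _ = (a : ℝ) ^ a * (b : ℝ) ^ b *
          (Real.exp (((a : ℝ) + b) * x - a) * Real.exp (((a : ℝ) + b) * (1 - x) - b)) := by ring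
      _ = _ := by rw [hs, mul_one]
  have h4 := h3.trans (pow_self_mul_pow_self_le a b hab)
  have h5 : ((a : ℝ) + b) ^ (a + b) * (x ^ a * (1 - x) ^ b) ≤
      ((a : ℝ) + b) ^ (a + b) * (2 * √((a : ℝ) + b) * mixtureProb a b) := by linarith
  exact le_of_mul_le_mul_left h5 (by positivity)

/-! ### Binary words and likelihood ratios -/

theorem prod_le_arith_mean_pow {ι : Type*} [Fintype ι] [Nonempty ι] {z : ι → ℝ}
    (hz : ∀ i, 0 ≤ z i) : ∏ i, z i ≤ ((∑ i, z i) / Fintype.card ι) ^ Fintype.card ι := by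
  have hM : (0 : ℝ) < Fintype.card ι := by exact_mod_cast Fintype.card_pos
  have h := Real.geom_mean_le_arith_mean_weighted Finset.univ
    (fun _ : ι => 1 / (Fintype.card ι : ℝ)) z (fun _ _ => by positivity)
    (by simp [hM.ne']) (fun i _ => hz i)
  rw [Real.finsetProd_rpow _ _ (fun i _ => hz i), ← Finset.mul_sum] at h
  have h2 := pow_le_pow_left₀ (Real.rpow_nonneg (Finset.prod_nonneg fun i _ => hz i) _) h
    (Fintype.card ι)
  rw [one_div, Real.rpow_inv_natCast_pow (Finset.prod_nonneg fun i _ => hz i)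
    Fintype.card_ne_zero] at h2
  rwa [div_eq_inv_mul]

theorem arith_mean_mem {ι : Type*} [Fintype ι] [Nonempty ι] {r : ι → ℝ} (hr : ∀ i, r i ∈ Set.Icc (0 : ℝ) 1) :
    (∑ i, r i) / Fintype.card ι ∈ Set.Icc (0 : ℝ) 1 := by
  have hM : (0 : ℝ) < Fintype.card ι := by exact_mod_cast Fintype.card_pos
  refine ⟨div_nonneg (Finset.sum_nonneg fun i _ => (hr i).1) hM.le, ?_⟩
  rw [div_le_one hM]
  simpa using Finset.sum_le_sum fun i (_ : i ∈ Finset.univ) => (hr i).2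

theorem betaMeasure_compl_Icc (α β : ℝ) : betaMeasure α β (Set.Icc 0 1)ᶜ = 0 := by
  rw [betaMeasure, withDensity_apply _ measurableSet_Icc.compl]
  refine setLIntegral_eq_zero measurableSet_Icc.compl fun x hx => ?_
  by_cases h : 0 < x
  · exact betaPDF_eq_zero_of_one_le (le_of_not_gt fun h1 => hx ⟨h.le, h1.le⟩)
  · exact betaPDF_eq_zero_of_nonpos (le_of_not_gt h)

/-- The probability that independent Bernoulli variables with means `x i` are equal to one exactly
on `s`. -/
noncomputable def wordProb {ι : Type*} [Fintype ι] [DecidableEq ι] (x : ι → ℝ) (s : Finset ι) : ℝ :=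
  ∏ i, if i ∈ s then x i else 1 - x i

section Word

variable {ι : Type*} [Fintype ι] [DecidableEq ι]

theorem wordProb_nonneg {x : ι → ℝ} (hx : ∀ i, x i ∈ Set.Icc (0 : ℝ) 1) (s : Finset ι) :
    0 ≤ wordProb x s := by
  refine Finset.prod_nonneg fun i _ => ?_
  split_ifs
  · exact (hx i).1
  · linarith [(hx i).2]

theorem prod_mul_add_mul (x : ι → ℝ) (A B : ℝ) :
    ∏ i, (x i * A + (1 - x i) * B) =
      ∑ s : Finset ι, wordProb x s * (A ^ s.card * B ^ (Fintype.card ι - s.card)) := by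
  rw [Fintype.prod_add]
  refine Finset.sum_congr rfl fun s _ => ?_
  rw [Finset.prod_mul_distrib, Finset.prod_mul_distrib, Finset.prod_const, Finset.prod_const,
    Finset.card_compl, wordProb, Finset.prod_ite]
  have e1 : (Finset.univ.filter fun i => i ∈ s) = s := by ext; simp
  have e2 : (Finset.univ.filter fun i => i ∉ s) = sᶜ := by ext; simp
  rw [e1, e2]
  ring

/-- Convexity of exp. The factor `1` is kept so that `prod_mul_add_mul` applies with `B = 1`. -/
theorem exp_mul_le_chord {x : ℝ} (hx : x ∈ Set.Icc (0 : ℝ) 1) (t : ℝ) :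
    Real.exp (t * x) ≤ x * Real.exp t + (1 - x) * 1 := by
  have := convexOn_exp.2 (Set.mem_univ t) (Set.mem_univ 0) hx.1 (sub_nonneg.2 hx.2) (by ring)
  simpa [mul_comm] using this

theorem one_sub_add_mul_exp_pos {p : ℝ} (hp : p ∈ Set.Icc (0 : ℝ) 1) (t : ℝ) :
    0 < 1 - p + p * Real.exp t := by
  rcases hp.1.eq_or_lt with h | h
  · rw [← h]; norm_num
  · have := mul_pos h (Real.exp_pos t)
    linarith [hp.2]

theorem exp_sub_log_eq {p : ℝ} (hp : p ∈ Set.Icc (0 : ℝ) 1) (t c : ℝ) (M : ℕ) :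
    Real.exp (c - M * Real.log (1 - p + p * Real.exp t)) =
      Real.exp c / (1 - p + p * Real.exp t) ^ M := by
  rw [Real.exp_sub, Real.exp_nat_mul, Real.exp_log (one_sub_add_mul_exp_pos hp t)]

/-- An upper bound, uniform in `t`, for the tilted likelihood of a word of length `M` with `k`
ones relative to mean `p`. -/
noncomputable def mixtureRatio (M k : ℕ) (p : ℝ) : ℝ≥0∞ :=
  ENNReal.ofReal (2 * √(M : ℝ) * mixtureProb k (M - k)) / ENNReal.ofReal (p ^ k * (1 - p) ^ (M - k))

theorem measurable_mixtureRatio (M k : ℕ) : Measurable (mixtureRatio M k) := by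
  unfold mixtureRatio
  fun_prop

/-- For 0 < p < 1 the left side is the likelihood ratio of a word with k ones between the tilted
parameter p eᵗ/(1 − p + p eᵗ) and p. The regret bound then replaces the tilted likelihood by the
mixture. -/
theorem ofReal_tilt_le_mixtureRatio {M k : ℕ} (hM : 0 < M) (hk : k ≤ M) {p : ℝ}
    (hp : p ∈ Set.Icc (0 : ℝ) 1) (t : ℝ) :
    ENNReal.ofReal (Real.exp t ^ k / (1 - p + p * Real.exp t) ^ M) ≤ mixtureRatio M k p := by
  have hu := one_sub_add_mul_exp_pos hp t
  have hp1 : 0 ≤ 1 - p := sub_nonneg.2 hp.2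
  have hnum : 0 < 2 * √(M : ℝ) * mixtureProb k (M - k) :=
    mul_pos (by positivity) (mixtureProb_pos _ _)
  rcases (mul_nonneg (pow_nonneg hp.1 k) (pow_nonneg hp1 (M - k))).eq_or_lt with h | h
  -- The ratio is `⊤` here. This is harmless: by `wordProb_eq_zero_of_mean` such a word has
  -- probability zero when p is the mean.
  · rw [mixtureRatio, ← h, ENNReal.ofReal_zero, ENNReal.div_zero (ENNReal.ofReal_pos.2 hnum).ne']
    exact le_top
  · rw [mixtureRatio, ← ENNReal.ofReal_div_of_pos h]
    refine ENNReal.ofReal_le_ofReal ?_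
    set u := 1 - p + p * Real.exp t with hudef
    have hx : p * Real.exp t / u ∈ Set.Icc (0 : ℝ) 1 :=
      ⟨div_nonneg (mul_nonneg hp.1 (Real.exp_pos t).le) hu.le, by
        rw [div_le_one hu]; linarith⟩
    have hb := pow_mul_pow_le_mixtureProb (a := k) (b := M - k) (by omega) hx
    have e1 : 1 - p * Real.exp t / u = (1 - p) / u := by
      field_simp
      linarith
    have eM : (k : ℝ) + ((M - k : ℕ) : ℝ) = M := by rw [Nat.cast_sub hk]; ring
    rw [e1, eM] at hb
    rw [le_div_iff₀ h]
    refine le_trans (le_of_eq ?_) hb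
    have epow : u ^ M = u ^ k * u ^ (M - k) := by rw [← pow_add]; congr 1; omega
    rw [epow, div_pow, div_pow, mul_pow]
    field_simp

/-- The bound of `exp (M kl)` for the word `x` by the Krichevsky–Trofimov mixture. -/
noncomputable def mixtureBound (x : ι → ℝ) (p : ℝ) : ℝ≥0∞ :=
  ∑ s : Finset ι, ENNReal.ofReal (wordProb x s) * mixtureRatio (Fintype.card ι) s.card p

theorem ofReal_exp_le_mixtureBound [Nonempty ι] {x : ι → ℝ} (hx : ∀ i, x i ∈ Set.Icc (0 : ℝ) 1)
    {p : ℝ} (hp : p ∈ Set.Icc (0 : ℝ) 1) (t : ℝ) :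
    ENNReal.ofReal (Real.exp (t * ∑ i, x i -
      Fintype.card ι * Real.log (1 - p + p * Real.exp t))) ≤ mixtureBound x p := by
  have hu := one_sub_add_mul_exp_pos hp t
  have h : Real.exp (t * ∑ i, x i - Fintype.card ι * Real.log (1 - p + p * Real.exp t)) ≤
      ∑ s : Finset ι, wordProb x s *
        (Real.exp t ^ s.card / (1 - p + p * Real.exp t) ^ Fintype.card ι) := by
    rw [exp_sub_log_eq hp]
    simp_rw [mul_div_assoc', ← Finset.sum_div]
    gcongr
    rw [Finset.mul_sum, Real.exp_sum]
    refine (Finset.prod_le_prod (fun i _ => (Real.exp_pos _).le)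
      fun i _ => exp_mul_le_chord (hx i) t).trans (le_of_eq ?_)
    rw [prod_mul_add_mul]
    simp
  refine (ENNReal.ofReal_le_ofReal h).trans ?_
  rw [ENNReal.ofReal_sum_of_nonneg fun s _ => mul_nonneg (wordProb_nonneg hx s) (by positivity)]
  refine Finset.sum_le_sum fun s _ => ?_
  rw [ENNReal.ofReal_mul (wordProb_nonneg hx s)]
  gcongr
  exact ofReal_tilt_le_mixtureRatio Fintype.card_pos (Finset.card_le_univ s) hp t

/-- With the mixture written as an integral over q, the sum over words factorises into ∏ (rᵢ q/p +
(1 − rᵢ)(1 − q)/(1 − p)). Since p is the mean of r, these factors have mean at most 1, and AM-GM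
handles unequal rᵢ. -/
theorem sum_wordProb_mul_mixtureProb_le [Nonempty ι] {r : ι → ℝ}
    (hr : ∀ i, r i ∈ Set.Icc (0 : ℝ) 1) {p : ℝ} (hp : p = (∑ i, r i) / Fintype.card ι) :
    ∑ s : Finset ι, wordProb r s * (mixtureProb s.card (Fintype.card ι - s.card) /
      (p ^ s.card * (1 - p) ^ (Fintype.card ι - s.card))) ≤ 1 := by
  have hM : (0 : ℝ) < Fintype.card ι := by exact_mod_cast Fintype.card_pos
  have hp01 : p ∈ Set.Icc (0 : ℝ) 1 := hp ▸ arith_mean_mem hr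
  have hp1 : 0 ≤ 1 - p := sub_nonneg.2 hp01.2
  have hprob : IsProbabilityMeasure (betaMeasure (1 / 2) (1 / 2)) :=
    isProbabilityMeasureBeta (by norm_num) (by norm_num)
  have hae : ∀ᵐ q ∂betaMeasure (1 / 2) (1 / 2), q ∈ Set.Icc (0 : ℝ) 1 := by
    rw [ae_iff]
    exact betaMeasure_compl_Icc _ _
  have hint : ∀ a b : ℕ, Integrable (fun q : ℝ => q ^ a * (1 - q) ^ b)
      (betaMeasure (1 / 2) (1 / 2)) := by
    intro a b
    refine Integrable.of_bound (by fun_prop) 1 ?_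
    filter_upwards [hae] with q hq
    have h1 : 0 ≤ 1 - q := sub_nonneg.2 hq.2
    rw [Real.norm_of_nonneg (mul_nonneg (pow_nonneg hq.1 _) (pow_nonneg h1 _))]
    exact mul_le_one₀ (pow_le_one₀ hq.1 hq.2) (pow_nonneg h1 _) (pow_le_one₀ h1 (by linarith [hq.1]))
  calc _ = ∫ q, ∑ s : Finset ι, wordProb r s * ((q ^ s.card *
        (1 - q) ^ (Fintype.card ι - s.card)) /
        (p ^ s.card * (1 - p) ^ (Fintype.card ι - s.card))) ∂betaMeasure (1 / 2) (1 / 2) := by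
        rw [integral_finsetSum _ fun s _ => ((hint _ _).div_const _).const_mul _]
        refine Finset.sum_congr rfl fun s _ => ?_
        rw [integral_const_mul, integral_div, mixtureProb]
    _ = ∫ q, ∏ i, (r i * (q / p) + (1 - r i) * ((1 - q) / (1 - p)))
        ∂betaMeasure (1 / 2) (1 / 2) := by
        refine integral_congr_ae (Filter.Eventually.of_forall fun q => ?_)
        simp only [prod_mul_add_mul]
        refine Finset.sum_congr rfl fun s _ => ?_
        rw [div_pow, div_pow, div_mul_div_comm]
    _ ≤ ∫ _, (1 : ℝ) ∂betaMeasure (1 / 2) (1 / 2) := by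
        refine integral_mono_of_nonneg ?_ (integrable_const _) ?_
        all_goals
          filter_upwards [hae] with q hq
          have h1 : 0 ≤ 1 - q := sub_nonneg.2 hq.2
          have hz : ∀ i, 0 ≤ r i * (q / p) + (1 - r i) * ((1 - q) / (1 - p)) := fun i =>
            add_nonneg (mul_nonneg (hr i).1 (div_nonneg hq.1 hp01.1))
              (mul_nonneg (sub_nonneg.2 (hr i).2) (div_nonneg h1 hp1))
        · exact Finset.prod_nonneg fun i _ => hz i
        · refine (prod_le_arith_mean_pow hz).trans (pow_le_one₀
            (div_nonneg (Finset.sum_nonneg fun i _ => hz i) hM.le) ?_)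
          -- If p is 0 or 1, one of `p / p` and `(1 - p) / (1 - p)` is `0` by the division
          -- convention, so only `≤ 1` is available below.
          have e : (∑ i, (r i * (q / p) + (1 - r i) * ((1 - q) / (1 - p)))) / Fintype.card ι =
              q * (p / p) + (1 - q) * ((1 - p) / (1 - p)) := by
            rw [Finset.sum_add_distrib, ← Finset.sum_mul, ← Finset.sum_mul,
              Finset.sum_sub_distrib, add_div]
            have hs : ∑ i, r i = p * Fintype.card ι := by rw [hp]; field_simp
            rw [hs]
            simp only [Finset.sum_const, Finset.card_univ, nsmul_eq_mul, mul_one]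
            field_simp
          rw [e]
          calc _ ≤ q * 1 + (1 - q) * 1 := by
                gcongr
                · exact hq.1
                · exact div_self_le_one p
                · exact div_self_le_one _
            _ = 1 := by ring
    _ = 1 := by rw [integral_const, probReal_univ, one_smul]

theorem wordProb_eq_zero_of_mean [Nonempty ι] {r : ι → ℝ}
    (hr : ∀ i, r i ∈ Set.Icc (0 : ℝ) 1) {p : ℝ} (hp : p = (∑ i, r i) / Fintype.card ι)
    {s : Finset ι} (h0 : p ^ s.card * (1 - p) ^ (Fintype.card ι - s.card) = 0) :
    wordProb r s = 0 := by
  have hM : (0 : ℝ) < Fintype.card ι := by exact_mod_cast Fintype.card_pos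
  rcases mul_eq_zero.1 h0 with h | h
  · obtain ⟨hp0, hs⟩ := pow_eq_zero_iff'.1 h
    obtain ⟨i, hi⟩ := Finset.card_ne_zero.1 hs
    have hsum : ∑ i, r i = 0 := by
      rw [hp0, eq_comm, div_eq_zero_iff] at hp
      exact hp.resolve_right hM.ne'
    have := (Finset.sum_eq_zero_iff_of_nonneg fun i _ => (hr i).1).1 hsum i (Finset.mem_univ i)
    exact Finset.prod_eq_zero (Finset.mem_univ i) (by simp [hi, this])
  · obtain ⟨hp1, hs⟩ := pow_eq_zero_iff'.1 h
    have hs' : sᶜ.card ≠ 0 := by rwa [Finset.card_compl]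
    obtain ⟨i, hi⟩ := Finset.card_ne_zero.1 hs'
    have hsum : ∑ i, (1 - r i) = 0 := by
      rw [eq_div_iff hM.ne'] at hp
      simp only [Finset.sum_sub_distrib, Finset.sum_const, Finset.card_univ, nsmul_eq_mul, mul_one]
      rw [← hp]
      linear_combination (Fintype.card ι : ℝ) * hp1
    have := (Finset.sum_eq_zero_iff_of_nonneg fun i _ => sub_nonneg.2 (hr i).2).1 hsum i
      (Finset.mem_univ i)
    exact Finset.prod_eq_zero (Finset.mem_univ i) (by rw [if_neg (Finset.mem_compl.1 hi), this])

theorem mixtureBound_mean_le [Nonempty ι] {r : ι → ℝ}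
    (hr : ∀ i, r i ∈ Set.Icc (0 : ℝ) 1) {p : ℝ} (hp : p = (∑ i, r i) / Fintype.card ι) :
    mixtureBound r p ≤ ENNReal.ofReal (2 * √(Fintype.card ι : ℝ)) := by
  have hp01 : p ∈ Set.Icc (0 : ℝ) 1 := hp ▸ arith_mean_mem hr
  have hd : ∀ s : Finset ι, 0 ≤ p ^ s.card * (1 - p) ^ (Fintype.card ι - s.card) := fun s =>
    mul_nonneg (pow_nonneg hp01.1 _) (pow_nonneg (sub_nonneg.2 hp01.2) _)
  have hnn : ∀ s : Finset ι, 0 ≤ wordProb r s * (mixtureProb s.card (Fintype.card ι - s.card) /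
      (p ^ s.card * (1 - p) ^ (Fintype.card ι - s.card))) := fun s =>
    mul_nonneg (wordProb_nonneg hr s) (div_nonneg (mixtureProb_pos _ _).le (hd s))
  have hterm : ∀ s : Finset ι, ENNReal.ofReal (wordProb r s) *
      mixtureRatio (Fintype.card ι) s.card p = ENNReal.ofReal (2 * √(Fintype.card ι : ℝ)) *
        ENNReal.ofReal (wordProb r s * (mixtureProb s.card (Fintype.card ι - s.card) /
      (p ^ s.card * (1 - p) ^ (Fintype.card ι - s.card)))) := by
    intro s
    rcases (hd s).eq_or_lt with h | h
    · simp [wordProb_eq_zero_of_mean hr hp h.symm]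
    · rw [mixtureRatio, ← ENNReal.ofReal_div_of_pos h, ← ENNReal.ofReal_mul (wordProb_nonneg hr s),
        ← ENNReal.ofReal_mul (by positivity)]
      congr 1
      ring
  rw [mixtureBound, Finset.sum_congr rfl fun s _ => hterm s, ← Finset.mul_sum,
    ← ENNReal.ofReal_sum_of_nonneg fun s _ => hnn s]
  calc _ ≤ ENNReal.ofReal (2 * √(Fintype.card ι : ℝ)) * ENNReal.ofReal 1 := by
        gcongr
        exact sum_wordProb_mul_mixtureProb_le hr hp
    _ = _ := by simp

end Word

/-! ### Variational formula for the binary divergence -/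

/-- Serves the endpoint a = 0 of `binKL_le`, and a = 1 after the reflection r ↦ 1 − r, t ↦ −t. The
supremum over t is reached in the limit t → −∞; for r = 1 the family is unbounded, so no `B` exists.
-/
theorem mulLogDiv_one_le {r B : ℝ} (hr : r ∈ Set.Icc (0 : ℝ) 1)
    (h : ∀ t : ℝ, -Real.log (1 - r + r * Real.exp t) ≤ B) :
    mulLogDiv 1 (1 - r) ≤ (B : EReal) := by
  rcases hr.2.eq_or_lt with rfl | hr1
  · have := h (-(B + 1))
    simp only [sub_self, zero_add, one_mul, Real.log_exp] at this
    linarith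
  · have h1 : 0 < 1 - r := sub_pos.2 hr1
    rw [mulLogDiv, if_neg one_ne_zero, if_neg h1.ne', EReal.coe_le_coe_iff, one_mul, one_div,
      Real.log_inv]
    have hlim : Filter.Tendsto (fun t : ℝ => -Real.log (1 - r + r * Real.exp t)) Filter.atBot
        (nhds (-Real.log (1 - r))) := by
      have : Filter.Tendsto (fun t : ℝ => 1 - r + r * Real.exp t) Filter.atBot
          (nhds (1 - r + r * 0)) :=
        (Real.tendsto_exp_atBot.const_mul r).const_add (1 - r)
      rw [mul_zero, add_zero] at this
      exact (this.log h1.ne').neg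
    exact le_of_tendsto hlim (Filter.Eventually.of_forall h)

/-- The variational formula for the binary divergence, as an upper bound. -/
theorem binKL_le {a r B : ℝ} (ha : a ∈ Set.Icc (0 : ℝ) 1) (hr : r ∈ Set.Icc (0 : ℝ) 1)
    (h : ∀ t : ℝ, t * a - Real.log (1 - r + r * Real.exp t) ≤ B) :
    binKL a r ≤ (B : EReal) := by
  rcases ha.1.eq_or_lt with rfl | ha0
  · have h1 := mulLogDiv_one_le hr (B := B) fun t => by simpa using h t
    simpa [binKL, mulLogDiv] using h1
  rcases ha.2.eq_or_lt with rfl | ha1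
  · have h1 := mulLogDiv_one_le (r := 1 - r) (B := B) ⟨by linarith [hr.2], by linarith [hr.1]⟩
      fun t => by
        have hpos := one_sub_add_mul_exp_pos hr (-t)
        have e : 1 - (1 - r) + (1 - r) * Real.exp t =
            Real.exp t * (1 - r + r * Real.exp (-t)) := by
          have := Real.exp_add t (-t)
          rw [add_neg_cancel, Real.exp_zero] at this
          linear_combination (-r) * (-this)
        rw [e, Real.log_mul (Real.exp_pos t).ne' hpos.ne', Real.log_exp]
        have := h (-t)
        linarith
    rw [sub_sub_cancel] at h1
    simpa [binKL, mulLogDiv] using h1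
  rcases hr.1.eq_or_lt with rfl | hr0
  · have := h ((B + 1) / a)
    simp only [zero_mul, sub_zero, add_zero, Real.log_one, div_mul_cancel₀ _ ha0.ne'] at this
    linarith
  rcases hr.2.eq_or_lt with rfl | hr1
  · have h1 : 0 < 1 - a := sub_pos.2 ha1
    have := h (-((B + 1) / (1 - a)))
    simp only [sub_self, zero_add, one_mul, Real.log_exp] at this
    have e : -((B + 1) / (1 - a)) * a - -((B + 1) / (1 - a)) = B + 1 := by field_simp; ring
    linarith
  have ha' : 0 < 1 - a := sub_pos.2 ha1
  have hr' : 0 < 1 - r := sub_pos.2 hr1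
  rw [binKL, mulLogDiv, mulLogDiv, if_neg ha0.ne', if_neg hr0.ne', if_neg ha'.ne', if_neg hr'.ne',
    ← EReal.coe_add, EReal.coe_le_coe_iff]
  -- The maximiser is the t whose tilted mean r eᵗ/(1 − r + r eᵗ) equals a.
  refine le_trans (le_of_eq ?_) (h (Real.log (a * (1 - r) / (r * (1 - a)))))
  rw [Real.exp_log (by positivity)]
  have e : 1 - r + r * (a * (1 - r) / (r * (1 - a))) = (1 - r) / (1 - a) := by
    field_simp
    ring
  rw [e, Real.log_div (by positivity) (by positivity), Real.log_div (by positivity) (by positivity),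
    Real.log_div (by positivity) (by positivity), Real.log_div (by positivity) (by positivity),
    Real.log_mul (by positivity) (by positivity), Real.log_mul (by positivity) (by positivity)]
  ring

/-! ### Change of measure, Jensen and Markov -/

/-- The change of measure inequality of Donsker and Varadhan for bounded functions. -/
theorem integral_le_klDiv_add_log {H : Type*} [MeasurableSpace H] {μ ν : Measure H}
    [IsProbabilityMeasure μ] [IsProbabilityMeasure ν] {g : H → ℝ} (hg : Measurable g) {C : ℝ}
    (hC : ∀ h, |g h| ≤ C) (hkl : klDiv μ ν ≠ ⊤) :
    ∫ h, g h ∂μ ≤ (klDiv μ ν).toReal + Real.log (∫ h, Real.exp (g h) ∂ν) := by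
  obtain ⟨hac, hint⟩ := klDiv_ne_top_iff.1 hkl
  have hgμ : Integrable g μ :=
    Integrable.of_bound hg.aestronglyMeasurable C (Filter.Eventually.of_forall hC)
  have hexp : Integrable (fun h => Real.exp (g h)) ν := by
    refine Integrable.of_bound (by fun_prop) (Real.exp C) (Filter.Eventually.of_forall fun h => ?_)
    rw [Real.norm_of_nonneg (Real.exp_pos _).le]
    exact Real.exp_le_exp.2 (le_of_abs_le (hC h))
  -- The claim is nonnegativity of the divergence of μ from the tilted measure, which equals KL(μ‖ν)
  -- − ∫ g dμ + log ∫ exp g dν.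
  have : IsProbabilityMeasure (ν.tilted g) := isProbabilityMeasure_tilted hexp
  have hac' : μ ≪ ν.tilted g := hac.trans (absolutelyContinuous_tilted hexp)
  have h0 := integral_llr_add_sub_measure_univ_nonneg hac'
    (integrable_llr_tilted_right hac hgμ hint hexp)
  rw [integral_llr_tilted_right hac hgμ hexp hint] at h0
  rw [toReal_klDiv_of_measure_eq hac (by simp)]
  simp only [probReal_univ] at h0
  linarith

theorem log_tilt_mem {p : ℝ} (hp : p ∈ Set.Icc (0 : ℝ) 1) (t : ℝ) :
    |Real.log (1 - p + p * Real.exp t)| ≤ |t| := by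
  have hu := one_sub_add_mul_exp_pos hp t
  have hp1 : 0 ≤ 1 - p := sub_nonneg.2 hp.2
  have e1 : (1 : ℝ) ≤ Real.exp |t| := Real.one_le_exp (abs_nonneg t)
  have e2 : Real.exp (-|t|) ≤ 1 := Real.exp_le_one_iff.2 (neg_nonpos.2 (abs_nonneg t))
  rw [abs_le]
  constructor
  · rw [Real.le_log_iff_exp_le hu]
    calc _ = (1 - p) * Real.exp (-|t|) + p * Real.exp (-|t|) := by ring
      _ ≤ (1 - p) * 1 + p * Real.exp t :=
        add_le_add (mul_le_mul_of_nonneg_left e2 hp1)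
          (mul_le_mul_of_nonneg_left (Real.exp_le_exp.2 (neg_abs_le t)) hp.1)
      _ = _ := by ring
  · rw [Real.log_le_iff_le_exp hu]
    calc _ = (1 - p) * 1 + p * Real.exp t := by ring
      _ ≤ (1 - p) * Real.exp |t| + p * Real.exp |t| :=
        add_le_add (mul_le_mul_of_nonneg_left e1 hp1)
          (mul_le_mul_of_nonneg_left (Real.exp_le_exp.2 (le_abs_self t)) hp.1)
      _ = _ := by ring

theorem integral_mem_Icc {H : Type*} [MeasurableSpace H] {μ : Measure H} [IsProbabilityMeasure μ]
    {p : H → ℝ} (hp : ∀ h, p h ∈ Set.Icc (0 : ℝ) 1) : ∫ h, p h ∂μ ∈ Set.Icc (0 : ℝ) 1 := by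
  refine ⟨integral_nonneg fun h => (hp h).1, ?_⟩
  have := integral_mono_of_nonneg (μ := μ) (Filter.Eventually.of_forall fun h => (hp h).1)
    (integrable_const 1) (Filter.Eventually.of_forall fun h => (hp h).2)
  simpa using this

theorem integrable_of_mem_Icc {H : Type*} [MeasurableSpace H] {μ : Measure H}
    [IsProbabilityMeasure μ] {p : H → ℝ} (hpm : Measurable p)
    (hp : ∀ h, p h ∈ Set.Icc (0 : ℝ) 1) : Integrable p μ :=
  Integrable.of_bound hpm.aestronglyMeasurable 1 (Filter.Eventually.of_forall fun h => by
    rw [Real.norm_of_nonneg (hp h).1]; exact (hp h).2)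

theorem integrable_log_tilt {H : Type*} [MeasurableSpace H] {μ : Measure H}
    [IsProbabilityMeasure μ] {p : H → ℝ} (hpm : Measurable p)
    (hp : ∀ h, p h ∈ Set.Icc (0 : ℝ) 1) (t : ℝ) :
    Integrable (fun h => Real.log (1 - p h + p h * Real.exp t)) μ := by
  have hm : Measurable fun h => Real.log (1 - p h + p h * Real.exp t) := by fun_prop
  exact Integrable.of_bound hm.aestronglyMeasurable |t|
    (Filter.Eventually.of_forall fun h => log_tilt_mem (hp h) t)

/-- Jensen for the logarithm, by integrating its tangent line at the mean `u`. -/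
theorem integral_log_tilt_le {H : Type*} [MeasurableSpace H] {μ : Measure H}
    [IsProbabilityMeasure μ] {p : H → ℝ} (hpm : Measurable p)
    (hp : ∀ h, p h ∈ Set.Icc (0 : ℝ) 1) (t : ℝ) :
    ∫ h, Real.log (1 - p h + p h * Real.exp t) ∂μ ≤
      Real.log (1 - ∫ h, p h ∂μ + (∫ h, p h ∂μ) * Real.exp t) := by
  set r := ∫ h, p h ∂μ with hr
  have hu := one_sub_add_mul_exp_pos (integral_mem_Icc (μ := μ) hp) t
  rw [← hr] at hu
  set u := 1 - r + r * Real.exp t with hudef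
  have hpi : Integrable p μ := integrable_of_mem_Icc hpm hp
  have hui : Integrable (fun h => 1 - p h + p h * Real.exp t) μ :=
    ((integrable_const 1).sub hpi).add (hpi.mul_const _)
  have hval : ∫ h, (1 - p h + p h * Real.exp t) ∂μ = u := by
    have h1 : Integrable (fun h => 1 - p h) μ := (integrable_const 1).sub hpi
    rw [integral_add h1 (hpi.mul_const _), integral_sub (integrable_const 1) hpi, integral_mul_const]
    simp [hudef, hr]
  have hlog : Integrable (fun h => Real.log (1 - p h + p h * Real.exp t)) μ :=
    integrable_log_tilt hpm hp t
  have hle : ∀ h, Real.log (1 - p h + p h * Real.exp t) ≤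
      Real.log u + ((1 - p h + p h * Real.exp t) / u - 1) := by
    intro h
    have hph := one_sub_add_mul_exp_pos (hp h) t
    have := Real.log_le_sub_one_of_pos (div_pos hph hu)
    rw [Real.log_div hph.ne' hu.ne'] at this
    linarith
  calc _ ≤ ∫ h, (Real.log u + ((1 - p h + p h * Real.exp t) / u - 1)) ∂μ :=
        integral_mono hlog ((integrable_const _).add ((hui.div_const _).sub (integrable_const _))) hle
    _ = Real.log u := by
      have h1 : Integrable (fun h => (1 - p h + p h * Real.exp t) / u - 1) μ :=
        (hui.div_const _).sub (integrable_const _)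
      rw [integral_add (integrable_const _) h1, integral_sub (hui.div_const _) (integrable_const _), integral_div, hval, div_self hu.ne']
      simp

/-- Donsker–Varadhan for the exponent of the tilt, then Jensen to move the μ-average inside the
logarithm. A `Ψ` that dominates the tilt for many t lets a single moment bound serve them all. -/
theorem tilt_le_klDiv_add_log {H : Type*} [MeasurableSpace H] {μ ν : Measure H}
    [IsProbabilityMeasure μ] [IsProbabilityMeasure ν] {q p : H → ℝ} (hqm : Measurable q)
    (hq : ∀ h, q h ∈ Set.Icc (0 : ℝ) 1) (hpm : Measurable p) (hp : ∀ h, p h ∈ Set.Icc (0 : ℝ) 1)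
    (M : ℕ) (t : ℝ) {Ψ : H → ℝ≥0∞}
    (hΨ : ∀ h, ENNReal.ofReal (Real.exp (t * (M * q h) -
      M * Real.log (1 - p h + p h * Real.exp t))) ≤ Ψ h)
    {K : ℝ} (hK : 0 < K) (hΨK : ∫⁻ h, Ψ h ∂ν ≤ ENNReal.ofReal K) (hkl : klDiv μ ν ≠ ⊤) :
    M * (t * ∫ h, q h ∂μ - Real.log (1 - ∫ h, p h ∂μ + (∫ h, p h ∂μ) * Real.exp t)) ≤
      (klDiv μ ν).toReal + Real.log K := by
  set g : H → ℝ := fun h => t * (M * q h) - M * Real.log (1 - p h + p h * Real.exp t) with hg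
  have hgm : Measurable g := by fun_prop
  have hgb : ∀ h, |g h| ≤ |t| * (M * 1) + M * |t| := by
    intro h
    refine (abs_sub _ _).trans (add_le_add ?_ ?_)
    · rw [abs_mul, abs_mul, Nat.abs_cast, abs_of_nonneg (hq h).1]
      gcongr
      exact (hq h).2
    · rw [abs_mul, Nat.abs_cast]
      refine mul_le_mul_of_nonneg_left ?_ (Nat.cast_nonneg M)
      exact log_tilt_mem (hp h) t
  have hdv := integral_le_klDiv_add_log hgm hgb hkl
  have hqi : Integrable q μ := integrable_of_mem_Icc hqm hq
  have hlog : Integrable (fun h => Real.log (1 - p h + p h * Real.exp t)) μ :=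
    integrable_log_tilt hpm hp t
  have hgi : ∫ h, g h ∂μ = t * (M * ∫ h, q h ∂μ) -
      M * ∫ h, Real.log (1 - p h + p h * Real.exp t) ∂μ := by
    rw [hg, integral_sub ((hqi.const_mul _).const_mul _) (hlog.const_mul _), integral_const_mul,
      integral_const_mul, integral_const_mul]
  have hexp : Integrable (fun h => Real.exp (g h)) ν := by
    refine Integrable.of_bound (by fun_prop) (Real.exp (|t| * (M * 1) + M * |t|))
      (Filter.Eventually.of_forall fun h => ?_)
    rw [Real.norm_of_nonneg (Real.exp_pos _).le]
    exact Real.exp_le_exp.2 (le_of_abs_le (hgb h))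
  have hexpK : ∫ h, Real.exp (g h) ∂ν ≤ K := by
    rw [← ENNReal.ofReal_le_ofReal_iff hK.le, ofReal_integral_eq_lintegral_ofReal hexp
      (Filter.Eventually.of_forall fun h => (Real.exp_pos _).le)]
    exact (lintegral_mono hΨ).trans hΨK
  have hlogK := Real.log_le_log (integral_exp_pos hexp) hexpK
  have hJ := mul_le_mul_of_nonneg_left (integral_log_tilt_le (μ := μ) hpm hp t)
    (Nat.cast_nonneg (α := ℝ) M)
  linarith

/-- Markov's inequality for a function averaged over a second probability space. -/
theorem exists_event_lintegral_le {Ω H : Type*} [MeasurableSpace Ω] [MeasurableSpace H]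
    (P : Measure Ω) [IsProbabilityMeasure P] (ν : Measure H) [IsProbabilityMeasure ν]
    {Ψ : Ω → H → ℝ≥0∞} (hΨ : Measurable (Function.uncurry Ψ)) {C δ : ℝ} (hC : 0 < C) (hδ : 0 < δ)
    (hΨC : ∀ h, ∫⁻ ω, Ψ ω h ∂P ≤ ENNReal.ofReal C) :
    ∃ E : Set Ω, MeasurableSet E ∧ ENNReal.ofReal (1 - δ) ≤ P E ∧
      ∀ ω ∈ E, ∫⁻ h, Ψ ω h ∂ν ≤ ENNReal.ofReal (C / δ) := by
  have hm : Measurable fun ω => ∫⁻ h, Ψ ω h ∂ν := hΨ.lintegral_prod_right'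
  have hE : MeasurableSet {ω | ∫⁻ h, Ψ ω h ∂ν ≤ ENNReal.ofReal (C / δ)} :=
    measurableSet_le hm measurable_const
  refine ⟨_, hE, ?_, fun ω hω => hω⟩
  have htot : ∫⁻ ω, ∫⁻ h, Ψ ω h ∂ν ∂P ≤ ENNReal.ofReal C := by
    -- Tonelli needs ν to be independent of ω: here the prior must not depend on the data.
    rw [lintegral_lintegral_swap hΨ.aemeasurable]
    exact (lintegral_mono hΨC).trans (by simp)
  have hcompl : P {ω | ∫⁻ h, Ψ ω h ∂ν ≤ ENNReal.ofReal (C / δ)}ᶜ ≤ ENNReal.ofReal δ := by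
    have h1 := mul_meas_ge_le_lintegral (μ := P) hm (ENNReal.ofReal (C / δ))
    have h2 : P {ω | ∫⁻ h, Ψ ω h ∂ν ≤ ENNReal.ofReal (C / δ)}ᶜ ≤
        P {ω | ENNReal.ofReal (C / δ) ≤ ∫⁻ h, Ψ ω h ∂ν} :=
      measure_mono fun ω hω => by
        rw [Set.mem_compl_iff, Set.mem_ofPred_eq, not_le] at hω
        exact hω.le
    have hpos : 0 < C / δ := div_pos hC hδ
    have h3 : ENNReal.ofReal (C / δ) * P {ω | ∫⁻ h, Ψ ω h ∂ν ≤ ENNReal.ofReal (C / δ)}ᶜ ≤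
        ENNReal.ofReal (C / δ) * ENNReal.ofReal δ := by
      rw [← ENNReal.ofReal_mul hpos.le, div_mul_cancel₀ _ hδ.ne']
      exact (by gcongr : _ ≤ _).trans (h1.trans htot)
    exact (ENNReal.mul_le_mul_iff_right (ENNReal.ofReal_pos.2 hpos).ne' ENNReal.ofReal_ne_top).1 h3
  rw [ENNReal.ofReal_sub _ hδ.le, ENNReal.ofReal_one, tsub_le_iff_right,
    ← prob_add_prob_compl (μ := P) hE]
  gcongr

/-! ### Model tuples and moments over the data -/

/-- The loss of the model tuple `f` at a single training example. -/
noncomputable def exampleLoss {F : Type*} {n : ℕ} {Z : Fin n → Type*} {m : Fin n → ℕ}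
    (loss : ∀ i, F → Z i → ℝ) (S : ∀ i, Fin (m i) → Z i)
    (f : Fin n → F) (σ : Σ i, Fin (m i)) : ℝ :=
  loss σ.1 (f σ.1) (S σ.1 σ.2)

/-- The expected loss of the model tuple `f` at a single training example. -/
noncomputable def exampleRisk {F : Type*} {n : ℕ} {Z : Fin n → Type*} [∀ i, MeasurableSpace (Z i)]
    (m : Fin n → ℕ) (D : ∀ i, Measure (Z i)) (loss : ∀ i, F → Z i → ℝ)
    (f : Fin n → F) (σ : Σ i, Fin (m i)) : ℝ :=
  ∫ z, loss σ.1 (f σ.1) z ∂D σ.1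

/-- The average training loss of the model tuple `f`. -/
noncomputable def tupleEmpRisk {F : Type*} {n : ℕ} {Z : Fin n → Type*} {m : Fin n → ℕ}
    (loss : ∀ i, F → Z i → ℝ) (S : ∀ i, Fin (m i) → Z i)
    (f : Fin n → F) : ℝ :=
  (∑ σ, exampleLoss loss S f σ) / Fintype.card (Σ i, Fin (m i))

/-- The sample-centric risk of the model tuple `f`. -/
noncomputable def tupleRisk {F : Type*} {n : ℕ} {Z : Fin n → Type*} [∀ i, MeasurableSpace (Z i)]
    (m : Fin n → ℕ) (D : ∀ i, Measure (Z i)) (loss : ∀ i, F → Z i → ℝ)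
    (f : Fin n → F) : ℝ :=
  (∑ σ, exampleRisk m D loss f σ) / Fintype.card (Σ i, Fin (m i))

theorem exampleLoss_mem {F : Type*} {n : ℕ} {Z : Fin n → Type*} {m : Fin n → ℕ}
    {loss : ∀ i, F → Z i → ℝ} (hloss_mem : ∀ i f z, loss i f z ∈ Set.Icc (0 : ℝ) 1)
    (S : ∀ i, Fin (m i) → Z i) (f : Fin n → F) (σ : Σ i, Fin (m i)) :
    exampleLoss loss S f σ ∈ Set.Icc (0 : ℝ) 1 :=
  hloss_mem _ _ _

theorem exampleRisk_mem {F : Type*} {n : ℕ} {Z : Fin n → Type*} [∀ i, MeasurableSpace (Z i)]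
    {m : Fin n → ℕ} {D : ∀ i, Measure (Z i)} [∀ i, IsProbabilityMeasure (D i)]
    {loss : ∀ i, F → Z i → ℝ} (hloss_mem : ∀ i f z, loss i f z ∈ Set.Icc (0 : ℝ) 1)
    (f : Fin n → F) (σ : Σ i, Fin (m i)) : exampleRisk m D loss f σ ∈ Set.Icc (0 : ℝ) 1 :=
  integral_mem_Icc fun _ => hloss_mem _ _ _

theorem tupleEmpRisk_mem {F : Type*} {n : ℕ} {Z : Fin n → Type*} {m : Fin n → ℕ}
    {loss : ∀ i, F → Z i → ℝ} [Nonempty (Σ i, Fin (m i))]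
    (hloss_mem : ∀ i f z, loss i f z ∈ Set.Icc (0 : ℝ) 1) (S : ∀ i, Fin (m i) → Z i)
    (f : Fin n → F) : tupleEmpRisk loss S f ∈ Set.Icc (0 : ℝ) 1 :=
  arith_mean_mem (exampleLoss_mem hloss_mem S f)

theorem tupleRisk_mem {F : Type*} {n : ℕ} {Z : Fin n → Type*} [∀ i, MeasurableSpace (Z i)]
    {m : Fin n → ℕ} {D : ∀ i, Measure (Z i)} [∀ i, IsProbabilityMeasure (D i)]
    {loss : ∀ i, F → Z i → ℝ} [Nonempty (Σ i, Fin (m i))]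
    (hloss_mem : ∀ i f z, loss i f z ∈ Set.Icc (0 : ℝ) 1)
    (f : Fin n → F) : tupleRisk m D loss f ∈ Set.Icc (0 : ℝ) 1 :=
  arith_mean_mem (exampleRisk_mem hloss_mem f)

section Task

variable {F : Type*} [MeasurableSpace F] {n : ℕ} {Z : Fin n → Type*} [∀ i, MeasurableSpace (Z i)]
  {m : Fin n → ℕ} {D : ∀ i, Measure (Z i)} [∀ i, IsProbabilityMeasure (D i)]
  {loss : ∀ i, F → Z i → ℝ}

instance dataLaw_isProbabilityMeasure : IsProbabilityMeasure (dataLaw m D) := by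
  unfold dataLaw
  infer_instance

theorem integral_dataLaw_prod (φ : ∀ σ : (Σ i, Fin (m i)), Z σ.1 → ℝ) :
    ∫ S, ∏ σ : (Σ i, Fin (m i)), φ σ (S σ.1 σ.2) ∂dataLaw m D = ∏ σ, ∫ z, φ σ z ∂D σ.1 := by
  simp_rw [Fintype.prod_sigma, dataLaw]
  rw [integral_fintype_prod_eq_prod
    (f := fun i (x : Fin (m i) → Z i) => ∏ j, φ ⟨i, j⟩ (x j))]
  refine Finset.prod_congr rfl fun i _ => ?_
  rw [integral_fintype_prod_eq_prod (f := fun j => φ ⟨i, j⟩)]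

theorem lintegral_dataLaw_prod {φ : ∀ σ : (Σ i, Fin (m i)), Z σ.1 → ℝ} {B : ℝ}
    (hφm : ∀ σ, Measurable (φ σ)) (hφ : ∀ σ z, φ σ z ∈ Set.Icc 0 B) :
    ∫⁻ S, ENNReal.ofReal (∏ σ : (Σ i, Fin (m i)), φ σ (S σ.1 σ.2)) ∂dataLaw m D =
      ENNReal.ofReal (∏ σ, ∫ z, φ σ z ∂D σ.1) := by
  have hm : Measurable fun S : (∀ i, Fin (m i) → Z i) =>
      ∏ σ : (Σ i, Fin (m i)), φ σ (S σ.1 σ.2) :=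
    Finset.measurable_prod _ fun σ _ => (hφm σ).comp
      ((measurable_pi_apply σ.2).comp (measurable_pi_apply σ.1))
  have hnn : ∀ S : (∀ i, Fin (m i) → Z i), 0 ≤ ∏ σ : (Σ i, Fin (m i)), φ σ (S σ.1 σ.2) :=
    fun S => Finset.prod_nonneg fun σ _ => (hφ σ _).1
  rw [← integral_dataLaw_prod, ofReal_integral_eq_lintegral_ofReal _
    (Filter.Eventually.of_forall hnn)]
  refine Integrable.of_bound hm.aestronglyMeasurable (B ^ Fintype.card (Σ i, Fin (m i)))
    (Filter.Eventually.of_forall fun S => ?_)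
  rw [Real.norm_of_nonneg (hnn S)]
  exact (Finset.prod_le_prod (fun σ _ => (hφ σ _).1) fun σ _ => (hφ σ _).2).trans (by simp)

theorem measurable_exampleLoss
    (hloss_meas : ∀ i, Measurable (fun x : F × Z i => loss i x.1 x.2)) (σ : Σ i, Fin (m i)) :
    Measurable fun x : (∀ i, Fin (m i) → Z i) × (Fin n → F) => exampleLoss loss x.1 x.2 σ := by
  unfold exampleLoss
  have h : Measurable fun x : (∀ i, Fin (m i) → Z i) × (Fin n → F) =>
      (x.2 σ.1, x.1 σ.1 σ.2) := by
    refine ((measurable_pi_apply σ.1).comp measurable_snd).prodMk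
      ((measurable_pi_apply σ.2).comp ((measurable_pi_apply σ.1).comp measurable_fst))
  exact (hloss_meas σ.1).comp h

theorem measurable_exampleRisk
    (hloss_meas : ∀ i, Measurable (fun x : F × Z i => loss i x.1 x.2)) (σ : Σ i, Fin (m i)) :
    Measurable fun f : Fin n → F => exampleRisk m D loss f σ := by
  have h : Measurable fun f : F => ∫ z, loss σ.1 f z ∂D σ.1 :=
    (StronglyMeasurable.integral_prod_right (hloss_meas σ.1).stronglyMeasurable).measurable
  exact h.comp (measurable_pi_apply σ.1)

theorem measurable_tupleEmpRisk
    (hloss_meas : ∀ i, Measurable (fun x : F × Z i => loss i x.1 x.2)) :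
    Measurable fun x : (∀ i, Fin (m i) → Z i) × (Fin n → F) => tupleEmpRisk loss x.1 x.2 :=
  (Finset.measurable_sum _ fun σ _ => measurable_exampleLoss hloss_meas σ).div_const _

theorem measurable_tupleRisk
    (hloss_meas : ∀ i, Measurable (fun x : F × Z i => loss i x.1 x.2)) :
    Measurable fun f : Fin n → F => tupleRisk m D loss f :=
  (Finset.measurable_sum _ fun σ _ => measurable_exampleRisk hloss_meas σ).div_const _

/-- `wordProb` is affine in each loss separately and the examples are independent, so averaging over
the data replaces every loss by its expectation. -/
theorem lintegral_mixtureBound_le [Nonempty (Σ i, Fin (m i))]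
    (hloss_meas : ∀ i, Measurable (fun x : F × Z i => loss i x.1 x.2))
    (hloss_mem : ∀ i f z, loss i f z ∈ Set.Icc (0 : ℝ) 1) (f : Fin n → F) :
    ∫⁻ S, mixtureBound (exampleLoss loss S f) (tupleRisk m D loss f) ∂dataLaw m D ≤
      ENNReal.ofReal (2 * √(Fintype.card (Σ i, Fin (m i)) : ℝ)) := by
  refine le_trans (le_of_eq ?_)
    (mixtureBound_mean_le (exampleRisk_mem (m := m) (D := D) hloss_mem f) (p := tupleRisk m D loss f)
      rfl)
  have hlm : ∀ σ : (Σ i, Fin (m i)), Measurable fun z => loss σ.1 (f σ.1) z := fun σ =>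
    (hloss_meas σ.1).comp measurable_prodMk_left
  have hm : ∀ s : Finset (Σ i, Fin (m i)), Measurable fun S : (∀ i, Fin (m i) → Z i) =>
      ENNReal.ofReal (wordProb (exampleLoss loss S f) s) := by
    intro s
    refine ENNReal.measurable_ofReal.comp (Finset.measurable_prod _ fun σ _ => ?_)
    have h : Measurable fun S : (∀ i, Fin (m i) → Z i) => exampleLoss loss S f σ :=
      (measurable_exampleLoss hloss_meas σ).comp measurable_prodMk_right
    split_ifs
    · exact h
    · exact measurable_const.sub h
  unfold mixtureBound
  rw [lintegral_finsetSum _ fun s _ => (hm s).mul_const _]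
  refine Finset.sum_congr rfl fun s _ => ?_
  rw [lintegral_mul_const _ (hm s)]
  congr 1
  have h := lintegral_dataLaw_prod (D := D) (B := 1)
    (φ := fun (σ : Σ i, Fin (m i)) z => if σ ∈ s then loss σ.1 (f σ.1) z else 1 - loss σ.1 (f σ.1) z)
    (fun σ => by
      split_ifs
      · exact hlm σ
      · exact measurable_const.sub (hlm σ))
    (fun σ z => by
      have := hloss_mem σ.1 (f σ.1) z
      split_ifs
      · exact this
      · exact ⟨sub_nonneg.2 this.2, by linarith [this.1]⟩)
  refine h.trans ?_
  congr 1
  refine Finset.prod_congr rfl fun σ _ => ?_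
  split_ifs
  · rfl
  · rw [integral_sub (integrable_const 1) (integrable_of_mem_Icc (hlm σ) fun z => hloss_mem _ _ z)]
    simp [exampleRisk]

/-- After the chord bound and independence, a product of normalised factors remains. Division by `u`
makes their mean exactly 1, so AM-GM gives the bound although the risks differ between tasks. -/
theorem lintegral_exp_tilt_le [Nonempty (Σ i, Fin (m i))]
    (hloss_meas : ∀ i, Measurable (fun x : F × Z i => loss i x.1 x.2))
    (hloss_mem : ∀ i f z, loss i f z ∈ Set.Icc (0 : ℝ) 1) (t : ℝ) (f : Fin n → F) :
    ∫⁻ S, ENNReal.ofReal (Real.exp (t * ∑ σ, exampleLoss loss S f σ -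
      Fintype.card (Σ i, Fin (m i)) *
        Real.log (1 - tupleRisk m D loss f + tupleRisk m D loss f * Real.exp t))) ∂dataLaw m D ≤
      ENNReal.ofReal 1 := by
  have hr := exampleRisk_mem (m := m) (D := D) hloss_mem f
  have hp : tupleRisk m D loss f ∈ Set.Icc (0 : ℝ) 1 := arith_mean_mem hr
  have hM : (0 : ℝ) < Fintype.card (Σ i, Fin (m i)) := by exact_mod_cast Fintype.card_pos
  set p := tupleRisk m D loss f with hpdef
  have hu := one_sub_add_mul_exp_pos hp t
  set u := 1 - p + p * Real.exp t with hudef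
  have hlm : ∀ σ : (Σ i, Fin (m i)), Measurable fun z => loss σ.1 (f σ.1) z := fun σ =>
    (hloss_meas σ.1).comp measurable_prodMk_left
  have hli : ∀ σ : (Σ i, Fin (m i)), Integrable (fun z => loss σ.1 (f σ.1) z) (D σ.1) := fun σ =>
    integrable_of_mem_Icc (hlm σ) fun z => hloss_mem _ _ z
  have hle : ∀ S : (∀ i, Fin (m i) → Z i), Real.exp (t * ∑ σ, exampleLoss loss S f σ -
      Fintype.card (Σ i, Fin (m i)) * Real.log u) ≤
      ∏ σ : (Σ i, Fin (m i)), ((1 - loss σ.1 (f σ.1) (S σ.1 σ.2) +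
        loss σ.1 (f σ.1) (S σ.1 σ.2) * Real.exp t) / u) := by
    intro S
    rw [hudef, exp_sub_log_eq hp, Finset.prod_div_distrib, Finset.prod_const, Finset.card_univ,
      Finset.mul_sum, Real.exp_sum]
    gcongr with σ
    exact (exp_mul_le_chord (hloss_mem _ _ _) t).trans (le_of_eq (by ring))
  refine (lintegral_mono fun S => ENNReal.ofReal_le_ofReal (hle S)).trans ?_
  rw [lintegral_dataLaw_prod (D := D) (B := (1 + Real.exp t) / u)
    (φ := fun (σ : Σ i, Fin (m i)) z =>
      (1 - loss σ.1 (f σ.1) z + loss σ.1 (f σ.1) z * Real.exp t) / u)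
    (fun σ => ((measurable_const.sub (hlm σ)).add ((hlm σ).mul_const _)).div_const _)
    (fun σ z => by
      have h := hloss_mem σ.1 (f σ.1) z
      refine ⟨div_nonneg (one_sub_add_mul_exp_pos h t).le hu.le, ?_⟩
      gcongr
      · linarith [h.1]
      · exact mul_le_of_le_one_left (Real.exp_pos t).le h.2)]
  refine ENNReal.ofReal_le_ofReal ?_
  have hval : ∀ σ : (Σ i, Fin (m i)),
      ∫ z, (1 - loss σ.1 (f σ.1) z + loss σ.1 (f σ.1) z * Real.exp t) / u ∂D σ.1 =
      (1 - exampleRisk m D loss f σ + exampleRisk m D loss f σ * Real.exp t) / u := by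
    intro σ
    have h1 : Integrable (fun z => 1 - loss σ.1 (f σ.1) z) (D σ.1) :=
      (integrable_const 1).sub (hli σ)
    rw [integral_div, integral_add h1 ((hli σ).mul_const _), integral_sub (integrable_const 1)
      (hli σ), integral_mul_const]
    simp [exampleRisk]
  rw [Finset.prod_congr rfl fun σ _ => hval σ]
  have hz : ∀ σ : (Σ i, Fin (m i)),
      0 ≤ (1 - exampleRisk m D loss f σ + exampleRisk m D loss f σ * Real.exp t) / u :=
    fun σ => div_nonneg (one_sub_add_mul_exp_pos (hr σ) t).le hu.le
  refine (prod_le_arith_mean_pow hz).trans (le_of_eq ?_)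
  have hs : ∑ σ, exampleRisk m D loss f σ = p * Fintype.card (Σ i, Fin (m i)) := by
    rw [hpdef, tupleRisk]; field_simp
  rw [← Finset.sum_div, Finset.sum_add_distrib, ← Finset.sum_mul, Finset.sum_sub_distrib, hs]
  simp only [Finset.sum_const, Finset.card_univ, nsmul_eq_mul, mul_one]
  have e : ((Fintype.card (Σ i, Fin (m i)) : ℝ) - p * Fintype.card (Σ i, Fin (m i)) +
      p * Fintype.card (Σ i, Fin (m i)) * Real.exp t) / u / Fintype.card (Σ i, Fin (m i)) = 1 := by
    rw [div_div, div_eq_one_iff_eq (by positivity), hudef]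
    ring
  rw [e, one_pow]

theorem card_sigma_eq_totalSamples (m : Fin n → ℕ) :
    Fintype.card (Σ i, Fin (m i)) = totalSamples m := by
  simp [totalSamples]

/-! ### Averages under the joint posterior -/

section Posterior

variable {hyperpost : Measure (Models F)} {Q : Fin n → Measure F}
  [IsProbabilityMeasure hyperpost] [∀ i, IsProbabilityMeasure (Q i)]

instance jointPosterior_isProbabilityMeasure :
    IsProbabilityMeasure (jointPosterior hyperpost Q) := by
  unfold jointPosterior
  infer_instance

/-- Each example involves one model only, so the averaged risks see just the marginals `Q i`. -/
theorem integral_jointPosterior_eval {g : F → ℝ} (hg : Measurable g) (i : Fin n) :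
    ∫ h, g (h.2 i) ∂jointPosterior hyperpost Q = ∫ f, g f ∂Q i := by
  rw [jointPosterior, integral_fun_snd (f := fun f : Fin n → F => g (f i)), probReal_univ, one_smul,
    integral_comp_eval hg.aestronglyMeasurable]

theorem integral_tupleEmpRisk (hm : ∀ i, 0 < m i)
    (hloss_meas : ∀ i, Measurable (fun x : F × Z i => loss i x.1 x.2))
    (hloss_mem : ∀ i f z, loss i f z ∈ Set.Icc (0 : ℝ) 1) (S : ∀ i, Fin (m i) → Z i) :
    ∫ h, tupleEmpRisk loss S h.2 ∂jointPosterior hyperpost Q = sampleEmpRisk m loss Q S := by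
  have hi : ∀ σ, Integrable (fun h => exampleLoss loss S h.2 σ) (jointPosterior hyperpost Q) :=
    fun σ => integrable_of_mem_Icc
      ((measurable_exampleLoss hloss_meas σ).comp (measurable_const.prodMk measurable_snd))
      (fun h => exampleLoss_mem hloss_mem S h.2 σ)
  unfold tupleEmpRisk
  rw [integral_div, integral_finsetSum _ fun σ _ => hi σ, Fintype.sum_sigma, card_sigma_eq_totalSamples,
    sampleEmpRisk, Finset.sum_div]
  refine Finset.sum_congr rfl fun i _ => ?_
  have hmi : (m i : ℝ) ≠ 0 := by exact_mod_cast (hm i).ne'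
  have h : ∀ j : Fin (m i), ∫ h, exampleLoss loss S h.2 ⟨i, j⟩ ∂jointPosterior hyperpost Q =
      gibbsLoss (loss i) (Q i) (S i j) := fun j =>
    integral_jointPosterior_eval (g := fun f => loss i f (S i j))
      ((hloss_meas i).comp measurable_prodMk_right) i
  rw [empRisk, Finset.sum_congr rfl fun j _ => h j]
  field_simp

theorem integral_tupleRisk
    (hloss_meas : ∀ i, Measurable (fun x : F × Z i => loss i x.1 x.2))
    (hloss_mem : ∀ i f z, loss i f z ∈ Set.Icc (0 : ℝ) 1) :
    ∫ h, tupleRisk m D loss h.2 ∂jointPosterior hyperpost Q = sampleRisk m D loss Q := by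
  have hi : ∀ σ, Integrable (fun h => exampleRisk m D loss h.2 σ) (jointPosterior hyperpost Q) :=
    fun σ => integrable_of_mem_Icc ((measurable_exampleRisk hloss_meas σ).comp measurable_snd)
      (fun h => exampleRisk_mem hloss_mem h.2 σ)
  unfold tupleRisk
  rw [integral_div, integral_finsetSum _ fun σ _ => hi σ, Fintype.sum_sigma, card_sigma_eq_totalSamples,
    sampleRisk, Finset.sum_div]
  refine Finset.sum_congr rfl fun i _ => ?_
  have h : ∀ j : Fin (m i), ∫ h, exampleRisk m D loss h.2 ⟨i, j⟩ ∂jointPosterior hyperpost Q =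
      risk (D i) (loss i) (Q i) := fun j => by
    refine (integral_jointPosterior_eval (g := fun f => ∫ z, loss i f z ∂D i)
      (StronglyMeasurable.integral_prod_right (hloss_meas i).stronglyMeasurable).measurable i).trans ?_
    exact integral_integral_swap (integrable_of_mem_Icc (hloss_meas i) fun x => hloss_mem _ _ _)
  rw [Finset.sum_congr rfl fun j _ => h j]
  simp only [Finset.sum_const, Finset.card_univ, Fintype.card_fin, nsmul_eq_mul]
  ring

end Posterior

/-! ### The PAC-Bayes bound and its two instances -/

instance jointPrior_isProbabilityMeasure (hyperprior : Measure (Models F))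
    [IsProbabilityMeasure hyperprior] : IsProbabilityMeasure (jointPrior n hyperprior) := by
  unfold jointPrior
  infer_instance

/-- The PAC-Bayes template: a dataset-dependent function of the models with bounded expectation that
dominates the exponential moments for all `t ∈ T` yields a bound that holds for all `t ∈ T` and all
posteriors simultaneously. -/
theorem exists_event_forall_tilt_le [Nonempty (Σ i, Fin (m i))] (hm : ∀ i, 0 < m i)
    (hloss_meas : ∀ i, Measurable (fun x : F × Z i => loss i x.1 x.2))
    (hloss_mem : ∀ i f z, loss i f z ∈ Set.Icc (0 : ℝ) 1)
    (hyperprior : Measure (Models F)) [IsProbabilityMeasure hyperprior]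
    {Ψ : (∀ i, Fin (m i) → Z i) → (Fin n → F) → ℝ≥0∞} (hΨ : Measurable (Function.uncurry Ψ))
    {C δ : ℝ} (hC : 0 < C) (hδ : 0 < δ)
    (hΨC : ∀ f, ∫⁻ S, Ψ S f ∂dataLaw m D ≤ ENNReal.ofReal C) (T : Set ℝ)
    (hdom : ∀ t ∈ T, ∀ S f, ENNReal.ofReal (Real.exp (t * ∑ σ, exampleLoss loss S f σ -
      Fintype.card (Σ i, Fin (m i)) *
        Real.log (1 - tupleRisk m D loss f + tupleRisk m D loss f * Real.exp t))) ≤ Ψ S f) :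
    ∃ E : Set (∀ i, Fin (m i) → Z i), MeasurableSet E ∧
      ENNReal.ofReal (1 - δ) ≤ dataLaw m D E ∧
      ∀ S ∈ E, ∀ (hyperpost : Measure (Models F)) (Q : Fin n → Measure F),
        IsProbabilityMeasure hyperpost → (∀ i, IsProbabilityMeasure (Q i)) →
        klDiv (jointPosterior hyperpost Q) (jointPrior n hyperprior) ≠ ⊤ → ∀ t ∈ T,
        totalSamples m * (t * sampleEmpRisk m loss Q S -
          Real.log (1 - sampleRisk m D loss Q + sampleRisk m D loss Q * Real.exp t)) ≤
        (klDiv (jointPosterior hyperpost Q) (jointPrior n hyperprior)).toReal +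
          Real.log (C / δ) := by
  -- The event controls the prior average of `Ψ` only. It is fixed before t and the posteriors,
  -- which makes the bound simultaneous.
  obtain ⟨E, hE, hPE, hES⟩ := exists_event_lintegral_le (dataLaw m D) (jointPrior n hyperprior)
    (Ψ := fun S h => Ψ S h.2)
    (hΨ.comp (measurable_fst.prodMk (measurable_snd.comp measurable_snd))) hC hδ
    (fun h => hΨC h.2)
  refine ⟨E, hE, hPE, fun S hS hyperpost Q hhp hQ hkl t ht => ?_⟩
  have hM : (Fintype.card (Σ i, Fin (m i)) : ℝ) ≠ 0 := by exact_mod_cast Fintype.card_ne_zero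
  have h := tilt_le_klDiv_add_log (μ := jointPosterior hyperpost Q) (ν := jointPrior n hyperprior)
    (q := fun h => tupleEmpRisk loss S h.2) (p := fun h => tupleRisk m D loss h.2)
    ((measurable_tupleEmpRisk hloss_meas).comp (measurable_const.prodMk measurable_snd))
    (fun h => tupleEmpRisk_mem hloss_mem S h.2)
    ((measurable_tupleRisk hloss_meas).comp measurable_snd)
    (fun h => tupleRisk_mem hloss_mem h.2) (Fintype.card (Σ i, Fin (m i))) t
    (fun h => by
      have := hdom t ht S h.2
      rwa [tupleEmpRisk, mul_div_cancel₀ _ hM])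
    (div_pos hC hδ) (hES S hS) hkl
  rwa [integral_tupleEmpRisk hm hloss_meas hloss_mem, integral_tupleRisk hloss_meas hloss_mem,
    card_sigma_eq_totalSamples] at h

end Task

theorem measurable_mixtureBound_exampleLoss {F : Type*} [MeasurableSpace F] {n : ℕ}
    {Z : Fin n → Type*} [∀ i, MeasurableSpace (Z i)]
    {m : Fin n → ℕ} {D : ∀ i, Measure (Z i)} [∀ i, IsProbabilityMeasure (D i)]
    {loss : ∀ i, F → Z i → ℝ}
    (hloss_meas : ∀ i, Measurable (fun x : F × Z i => loss i x.1 x.2)) :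
    Measurable fun x : (∀ i, Fin (m i) → Z i) × (Fin n → F) =>
      mixtureBound (exampleLoss loss x.1 x.2) (tupleRisk m D loss x.2) := by
  refine Finset.measurable_sum _ fun s _ => Measurable.mul ?_ ?_
  · refine ENNReal.measurable_ofReal.comp (Finset.measurable_prod _ fun σ _ => ?_)
    split_ifs
    · exact measurable_exampleLoss hloss_meas σ
    · exact measurable_const.sub (measurable_exampleLoss hloss_meas σ)
  · exact (measurable_mixtureRatio _ _).comp ((measurable_tupleRisk hloss_meas).comp measurable_snd)

theorem measurable_exp_tilt {F : Type*} [MeasurableSpace F] {n : ℕ}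
    {Z : Fin n → Type*} [∀ i, MeasurableSpace (Z i)]
    {m : Fin n → ℕ} {D : ∀ i, Measure (Z i)} [∀ i, IsProbabilityMeasure (D i)]
    {loss : ∀ i, F → Z i → ℝ}
    (hloss_meas : ∀ i, Measurable (fun x : F × Z i => loss i x.1 x.2)) (t : ℝ) :
    Measurable fun x : (∀ i, Fin (m i) → Z i) × (Fin n → F) =>
      ENNReal.ofReal (Real.exp (t * ∑ σ, exampleLoss loss x.1 x.2 σ -
        Fintype.card (Σ i, Fin (m i)) *
          Real.log (1 - tupleRisk m D loss x.2 + tupleRisk m D loss x.2 * Real.exp t))) := by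
  have h1 : Measurable fun x : (∀ i, Fin (m i) → Z i) × (Fin n → F) =>
      ∑ σ, exampleLoss loss x.1 x.2 σ :=
    Finset.measurable_sum _ fun σ _ => measurable_exampleLoss hloss_meas σ
  have h2 : Measurable fun x : (∀ i, Fin (m i) → Z i) × (Fin n → F) => tupleRisk m D loss x.2 :=
    (measurable_tupleRisk hloss_meas).comp measurable_snd
  fun_prop

theorem nonempty_sigma_fin {n : ℕ} (hn : 0 < n) {m : Fin n → ℕ} (hm : ∀ i, 0 < m i) :
    Nonempty (Σ i, Fin (m i)) :=
  ⟨⟨⟨0, hn⟩, ⟨0, hm _⟩⟩⟩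

end MTL

theorem theorem3p3 {F : Type*} [MeasurableSpace F] (n : ℕ) (hn : 0 < n)
    {Z : Fin n → Type*} [∀ i, MeasurableSpace (Z i)]
    (m : Fin n → ℕ) (hm : ∀ i, 0 < m i)
    (D : ∀ i, Measure (Z i)) [∀ i, IsProbabilityMeasure (D i)]
    (loss : ∀ i, F → Z i → ℝ)
    (hloss_meas : ∀ i, Measurable (fun x : F × Z i => loss i x.1 x.2))
    (hloss_mem : ∀ i f z, loss i f z ∈ Set.Icc (0 : ℝ) 1)
    (hyperprior : Measure (MTL.Models F)) [IsProbabilityMeasure hyperprior]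
    (δ : ℝ) (hδ : 0 < δ) :
    (∃ E : Set (∀ i, Fin (m i) → Z i), MeasurableSet E ∧
      ENNReal.ofReal (1 - δ) ≤ MTL.dataLaw m D E ∧
      ∀ S ∈ E, ∀ (hyperpost : Measure (MTL.Models F)) (Q : Fin n → Measure F),
        IsProbabilityMeasure hyperpost → (∀ i, IsProbabilityMeasure (Q i)) →
        MTL.binKL (MTL.sampleEmpRisk m loss Q S) (MTL.sampleRisk m D loss Q) ≤
          ((klDiv (MTL.jointPosterior hyperpost Q) (MTL.jointPrior n hyperprior) : EReal) +
            ((Real.log (2 * Real.sqrt (MTL.totalSamples m : ℝ) / δ) : ℝ) : EReal)) /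
            (((MTL.totalSamples m : ℝ) : ℝ) : EReal)) ∧
    (∀ lam : ℝ, 0 < lam →
      ∃ E : Set (∀ i, Fin (m i) → Z i), MeasurableSet E ∧
        ENNReal.ofReal (1 - δ) ≤ MTL.dataLaw m D E ∧
        ∀ S ∈ E, ∀ (hyperpost : Measure (MTL.Models F)) (Q : Fin n → Measure F),
          IsProbabilityMeasure hyperpost → (∀ i, IsProbabilityMeasure (Q i)) →
          ((-((MTL.totalSamples m : ℝ) / lam) *
              Real.log (1 - MTL.sampleRisk m D loss Q +
                MTL.sampleRisk m D loss Q * Real.exp (-lam / (MTL.totalSamples m : ℝ))) : ℝ) :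
              EReal) ≤
            ((MTL.sampleEmpRisk m loss Q S : ℝ) : EReal) +
              ((klDiv (MTL.jointPosterior hyperpost Q) (MTL.jointPrior n hyperprior) : EReal) +
                ((Real.log (1 / δ) : ℝ) : EReal)) / ((lam : ℝ) : EReal)) := by
  have hne := MTL.nonempty_sigma_fin hn hm
  have hM : (0 : ℝ) < MTL.totalSamples m := by
    rw [← MTL.card_sigma_eq_totalSamples]
    exact_mod_cast Fintype.card_pos
  -- An infinite divergence makes both right-hand sides trivial, so the change of measure is needed
  -- only when it is finite.
  have top_case : ∀ b c : ℝ, 0 < c → (((⊤ : ℝ≥0∞) : EReal) + (b : EReal)) / (c : EReal) = ⊤ := by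
    intro b c hc
    rw [EReal.coe_ennreal_top, EReal.top_add_coe,
      EReal.top_div_of_pos_ne_top (by exact_mod_cast hc) (EReal.coe_ne_top c)]
  constructor
  · obtain ⟨E, hE, hPE, hES⟩ := MTL.exists_event_forall_tilt_le (D := D) hm hloss_meas hloss_mem
      hyperprior (MTL.measurable_mixtureBound_exampleLoss (D := D) hloss_meas)
      (mul_pos two_pos (Real.sqrt_pos.2 (by rwa [← MTL.card_sigma_eq_totalSamples] at hM))) hδ
      (MTL.lintegral_mixtureBound_le hloss_meas hloss_mem) Set.univ
      (fun t _ S f => MTL.ofReal_exp_le_mixtureBound (MTL.exampleLoss_mem hloss_mem S f)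
        (MTL.tupleRisk_mem hloss_mem f) t)
    refine ⟨E, hE, hPE, fun S hS hyperpost Q hhp hQ => ?_⟩
    by_cases hkl : klDiv (MTL.jointPosterior hyperpost Q) (MTL.jointPrior n hyperprior) = ⊤
    · rw [hkl, top_case _ _ hM]
      exact le_top
    rw [← EReal.coe_ennreal_toReal hkl, ← EReal.coe_add, ← EReal.coe_div]
    -- The event does not depend on t, so the bounds for all t pass to the supremum.
    refine MTL.binKL_le ?_ ?_ fun t => ?_
    · rw [← MTL.integral_tupleEmpRisk (hyperpost := hyperpost) hm hloss_meas hloss_mem]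
      exact MTL.integral_mem_Icc fun h => MTL.tupleEmpRisk_mem hloss_mem S h.2
    · rw [← MTL.integral_tupleRisk (hyperpost := hyperpost) hloss_meas hloss_mem]
      exact MTL.integral_mem_Icc fun h => MTL.tupleRisk_mem hloss_mem h.2
    · have h := hES S hS hyperpost Q hhp hQ hkl t (Set.mem_univ t)
      rw [MTL.card_sigma_eq_totalSamples] at h
      rw [le_div_iff₀ hM, mul_comm]
      exact h
  · intro lam hlam
    -- For the single value t = −λ/M, `Ψ` can be the tilt itself, with `C = 1`; the factor 2√M is
    -- the price of uniformity in t.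
    obtain ⟨E, hE, hPE, hES⟩ := MTL.exists_event_forall_tilt_le (D := D) hm hloss_meas hloss_mem
      hyperprior (MTL.measurable_exp_tilt (D := D) hloss_meas (-lam / MTL.totalSamples m))
      one_pos hδ (MTL.lintegral_exp_tilt_le hloss_meas hloss_mem _) {-lam / MTL.totalSamples m}
      (fun t ht S f => by rw [Set.mem_singleton_iff.1 ht])
    refine ⟨E, hE, hPE, fun S hS hyperpost Q hhp hQ => ?_⟩
    by_cases hkl : klDiv (MTL.jointPosterior hyperpost Q) (MTL.jointPrior n hyperprior) = ⊤
    · rw [hkl, top_case _ _ hlam, EReal.coe_add_top]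
      exact le_top
    rw [← EReal.coe_ennreal_toReal hkl, ← EReal.coe_add, ← EReal.coe_div, ← EReal.coe_add,
      EReal.coe_le_coe_iff]
    have h := hES S hS hyperpost Q hhp hQ hkl _ rfl
    rw [← sub_le_iff_le_add', le_div_iff₀ hlam]
    refine le_trans (le_of_eq ?_) h
    field_simp
    ring
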